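/- **Setting.** For $\delta\in 2^{-\mathbb N}$ let $\mathcal D_\delta(S)$ be the set of half-open dyadic squares of side $\delta$ in $\mathbb R^2$ that meet $S$, and $|S|_\delta=|\mathcal D_\delta(S)|$. A nonempty bounded set $S\subset\mathbb R^2$ is a $(\delta,s,C)$-set if $|S\cap B(x,r)|_\delta\le C r^s|S|_\delta$ for all $x\in\mathbb R^2$, $r\in[\delta,1]$; a finite set of dyadic $\delta$-squares is a $(\delta,s,C)$-set if its union is. A dyadic $\delta$-tube is $\bigcup_{(a,b)\in q}\{(x,y):y=ax+b\}$ with $q\in\mathcal D_\delta([-1,1]\times\mathbb R)$; a finite set of dyadic $\delta$-tubes is a $(\delta,s,C)$-set if the set of the squares $q$ is. For a set $\mathcal P$ of squares, $\mathcal D_w(\mathcal P)$ and $|\mathcal P|_w$ refer to the union of $\mathcal P$. For a dyadic $\delta$-tube $T$ and a dyadic scale $w\ge\delta$, $T^w$ is the dyadic $w$-tube containing $T$, and $6(T^w)$ is the $6w$-neighbourhood of $T^w$; $|6(T^w)\cap\mathcal D_w(\mathcal P)|$ is the number of squares in $\mathcal D_w(\mathcal P)$ contained in $6(T^w)$. A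 $\delta$-configuration $(\mathcal P,\mathcal T)$ consists of a set $\mathcal P\subset\mathcal D_\delta([0,1)^2)$, a finite set $\mathcal T$ of dyadic $\delta$-tubes, and sets $\mathcal T(p)\subset\mathcal T$ $(p\in\mathcal P)$ of tubes meeting $p$. Fix $L\ge1$. The configuration is $(\delta,s,C,M)$-nice ($M\in\mathbb N$) if every $\mathcal T(p)$ is a $(\delta,s,C)$-set with $L^{-1}M\le|\mathcal T(p)|\le LM$. **Proposition.** There is an absolute constant $\Delta_0\in(0,1)$ such that for all $L\ge 1$ and all integers $n\ge1$ there are constants $A,B$, and $K_\varepsilon$ for $\varepsilon\in(0,1/n]$, depending only on $L$, $n$ (and $K_\varepsilon$ also on $\varepsilon$), with the following property. Let $\Delta\in2^{-\mathbb N}$ with $\Delta<\Delta_0$, let $\delta=\Delta^n$, $s\in[0,1]$, $t\in[0,2]$, $s+t\ge2$, $C_0>0$, $M_0\in\mathbb N$, and let $(\mathcal P_0,\mathcal T_0)$ be a $(\delta,s,C_0,M_0)$-nice configuration such that $\mathcal P_0$ is a $(\delta,t,C_0)$-set. Then there is a refinement $(\mathcal P,\mathcal T)$ of $(\mathcal P_0,\mathcal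 T_0)$, i.e. a $\delta$-configuration with $\mathcal P\subset\mathcal P_0$, $\mathcal T\subset\mathcal T_0$, $\mathcal T(p)\subset\mathcal T_0(p)$ for $p\in\mathcal P$, $$|\mathcal P_0|\le B\,(\log\tfrac1\delta)^A|\mathcal P|,\qquad |\mathcal P_0|M_0\le B\,(\log\tfrac1\delta)^A\sum_{p\in\mathcal P}|\mathcal T(p)|,$$ such that for all $\varepsilon\in(0,1/n]$, all integers $1\le k\le n$ with $w=\Delta^k$, and all $T\in\mathcal T$, $$|6(T^w)\cap\mathcal D_w(\mathcal P)|\le K_\varepsilon(\log\tfrac1\delta)^A\,C_0^2\,\Delta^{-1}\,|\mathcal P|_w\,w^{1-\varepsilon}.$$ In particular, for all $\varepsilon\in(0,1/n]$, $$\delta^{-1+\varepsilon}M_0\le K_\varepsilon(\log\tfrac1\delta)^A\,C_0^2\,\Delta^{-1}\,|\mathcal T|,$$ that is, $|\mathcal T_0|\ge|\mathcal T|\gtrsim\delta^{-1+\varepsilon}M_0$ up to the factor $C_0^{2}\Delta^{-1}=C_0^2\delta^{-1/n}$ and powers of $\log\frac1\delta$. -/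

import Mathlib

/-- The Euclidean plane. -/
abbrev Plane : Type := EuclideanSpace ℝ (Fin 2)

/-- The half-open square `[aδ, (a+1)δ) × [bδ, (b+1)δ)` with index `i = (a, b)`.
For `δ > 0` distinct indices give distinct squares, see `dyadicSquare_injective`, so a family of
dyadic `δ`-squares is given by its set of indices. -/
def dyadicSquare (δ : ℝ) (i : ℤ × ℤ) : Set Plane :=
  {x | (i.1 : ℝ) * δ ≤ x 0 ∧ x 0 < ((i.1 : ℝ) + 1) * δ ∧
    (i.2 : ℝ) * δ ≤ x 1 ∧ x 1 < ((i.2 : ℝ) + 1) * δ}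

/-- `𝒟_δ(S)`: (the indices of) the dyadic `δ`-squares that meet `S`. -/
def dyadicCover (δ : ℝ) (S : Set Plane) : Set (ℤ × ℤ) :=
  {i | (dyadicSquare δ i ∩ S).Nonempty}

/-- The dyadic covering number `|S|_δ` (for bounded `S`). -/
noncomputable def coveringNumber (δ : ℝ) (S : Set Plane) : ℕ :=
  (dyadicCover δ S).ncard

/-- The union of a family of dyadic `δ`-squares. -/
def unionSquares (δ : ℝ) (P : Finset (ℤ × ℤ)) : Set Plane :=
  ⋃ i ∈ P, dyadicSquare δ i

/-- `A` is a `(δ, s, C)`-set. -/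
structure IsDeltaSet (δ s C : ℝ) (A : Set Plane) : Prop where
  nonempty : A.Nonempty
  bounded : Bornology.IsBounded A
  card_le : ∀ (x : Plane) (r : ℝ), δ ≤ r → r ≤ 1 →
    (coveringNumber δ (A ∩ Metric.ball x r) : ℝ) ≤ C * r ^ s * (coveringNumber δ A : ℝ)

/-- Point-line duality: the point `(a, b)` is sent to the line `y = a x + b`. -/
def dualLine (v : Plane) : Set Plane :=
  {z | z 1 = v 0 * z 0 + v 1}

/-- The point set `⋃_{v ∈ q} 𝐃(v)` of the tube dual to the dyadic `δ`-square `q` with index `i`.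
For `δ > 0` distinct indices give distinct tubes, see `dyadicTube_injective`, so a family of
dyadic `δ`-tubes is given by the set of indices of the dual squares. -/
def dyadicTube (δ : ℝ) (i : ℤ × ℤ) : Set Plane :=
  ⋃ v ∈ dyadicSquare δ i, dualLine v

/-- The unit square `[0,1)²`. -/
def unitSquare : Set Plane := {x | 0 ≤ x 0 ∧ x 0 < 1 ∧ 0 ≤ x 1 ∧ x 1 < 1}

/-- The strip `[-1,1] × ℝ`, the parameter set of dyadic tubes. -/
def slopeStrip : Set Plane := {x | -1 ≤ x 0 ∧ x 0 ≤ 1}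

/-- A `δ`-configuration: a set `P` of dyadic `δ`-squares in the unit square, a finite set `T` of
dyadic `δ`-tubes, and for each `p ∈ P` a set `Tp p ⊆ T` of tubes that meet `p`. -/
structure Configuration (δ : ℝ) where
  P : Finset (ℤ × ℤ)
  T : Finset (ℤ × ℤ)
  Tp : ℤ × ℤ → Finset (ℤ × ℤ)
  squares : ∀ p ∈ P, p ∈ dyadicCover δ unitSquare
  tubes : ∀ q ∈ T, q ∈ dyadicCover δ slopeStrip
  Tp_subset : ∀ p ∈ P, Tp p ⊆ T
  Tp_meets : ∀ p ∈ P, ∀ q ∈ Tp p, (dyadicTube δ q ∩ dyadicSquare δ p).Nonempty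

/-- The configuration is `(δ, s, C, M)`-nice, where `|𝒯(p)| ∼ M` holds with the constant `L`.
A set of tubes is a `(δ, s, C)`-set if the union of the dual squares is. -/
structure Configuration.IsNice {δ : ℝ} (X : Configuration δ) (s C : ℝ) (M : ℕ) (L : ℝ) :
    Prop where
  deltaSet : ∀ p ∈ X.P, IsDeltaSet δ s C (unionSquares δ (X.Tp p))
  le_card : ∀ p ∈ X.P, (M : ℝ) ≤ L * ((X.Tp p).card : ℝ)
  card_le : ∀ p ∈ X.P, ((X.Tp p).card : ℝ) ≤ L * (M : ℝ)

/-- `Y` is a refinement of the configuration `X` (nice with parameter `M`), where the losses `≈_δ`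
and `⪆_δ` are at most `B * log (1/δ) ^ A`. -/
structure Configuration.IsRefinement {δ : ℝ} (Y X : Configuration δ) (M : ℕ) (B : ℝ) (A : ℕ) :
    Prop where
  P_subset : Y.P ⊆ X.P
  T_subset : Y.T ⊆ X.T
  Tp_subset : ∀ p ∈ Y.P, Y.Tp p ⊆ X.Tp p
  card_P : (X.P.card : ℝ) ≤ B * Real.log (1 / δ) ^ A * (Y.P.card : ℝ)
  card_Tp : (X.P.card : ℝ) * (M : ℝ) ≤
    B * Real.log (1 / δ) ^ A * ∑ p ∈ Y.P, ((Y.Tp p).card : ℝ)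

/-- `|6W ∩ 𝒟_w(S)|`: the number of dyadic `w`-squares meeting `S` that are contained in the
`6w`-neighbourhood of the dyadic `w`-tube with index `W`. -/
noncomputable def incidenceCount (w : ℝ) (W : ℤ × ℤ) (S : Set Plane) : ℕ :=
  {p ∈ dyadicCover w S | dyadicSquare w p ⊆ Metric.cthickening (6 * w) (dyadicTube w W)}.ncard

theorem mem_dyadicTube {δ : ℝ} {i : ℤ × ℤ} {z : Plane} :
    z ∈ dyadicTube δ i ↔ ∃ v ∈ dyadicSquare δ i, z 1 = v 0 * z 0 + v 1 := by
  simp [dyadicTube, dualLine]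

theorem corner_mem_dyadicSquare {δ : ℝ} (hδ : 0 < δ) (i : ℤ × ℤ) :
    (!₂[(i.1 : ℝ) * δ, (i.2 : ℝ) * δ] : Plane) ∈ dyadicSquare δ i := by
  refine ⟨?_, ?_, ?_, ?_⟩ <;> simp <;> nlinarith

theorem dyadicSquare_injective {δ : ℝ} (hδ : 0 < δ) : Function.Injective (dyadicSquare δ) := by
  have key : ∀ i j : ℤ × ℤ, dyadicSquare δ i = dyadicSquare δ j → i.1 ≤ j.1 ∧ i.2 ≤ j.2 := by
    intro i j h
    have hi := corner_mem_dyadicSquare hδ i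
    rw [h] at hi
    obtain ⟨_, h2, _, h4⟩ := hi
    simp only [Matrix.cons_val_zero, Matrix.cons_val_one] at h2 h4
    have h2' := lt_of_mul_lt_mul_right h2 hδ.le
    have h4' := lt_of_mul_lt_mul_right h4 hδ.le
    norm_cast at h2' h4'
    omega
  intro i j h
  have h1 := key i j h
  have h2 := key j i h.symm
  ext <;> omega

theorem dyadicTube_injective {δ : ℝ} (hδ : 0 < δ) : Function.Injective (dyadicTube δ) := by
  have key : ∀ i j : ℤ × ℤ, dyadicTube δ i ⊆ dyadicTube δ j → i.2 = j.2 ∧ j.1 ≤ i.1 := by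
    intro i j h
    have h0 : (!₂[(0 : ℝ), (i.2 : ℝ) * δ] : Plane) ∈ dyadicTube δ j :=
      h (mem_dyadicTube.2 ⟨_, corner_mem_dyadicSquare hδ i, by simp⟩)
    have h1 : (!₂[(1 : ℝ), (i.1 : ℝ) * δ + (i.2 : ℝ) * δ] : Plane) ∈ dyadicTube δ j :=
      h (mem_dyadicTube.2 ⟨_, corner_mem_dyadicSquare hδ i, by simp⟩)
    have h2 : (!₂[(-1 : ℝ), -((i.1 : ℝ) * δ) + (i.2 : ℝ) * δ] : Plane) ∈ dyadicTube δ j :=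
      h (mem_dyadicTube.2 ⟨_, corner_mem_dyadicSquare hδ i, by simp⟩)
    obtain ⟨u, ⟨_, _, hu3, hu4⟩, hu⟩ := mem_dyadicTube.1 h0
    obtain ⟨v, ⟨hv1, hv2, hv3, hv4⟩, hv⟩ := mem_dyadicTube.1 h1
    obtain ⟨x, ⟨hx1, hx2, hx3, hx4⟩, hx⟩ := mem_dyadicTube.1 h2
    simp only [Matrix.cons_val_zero, Matrix.cons_val_one] at hu hv hx
    have a1 : (i.2 : ℝ) * δ < ((j.2 : ℝ) + 1) * δ := by linarith
    have a2 : (j.2 : ℝ) * δ < ((i.2 : ℝ) + 1) * δ := by linarith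
    have b1 := lt_of_mul_lt_mul_right a1 hδ.le
    have b2 := lt_of_mul_lt_mul_right a2 hδ.le
    norm_cast at b1 b2
    have e : i.2 = j.2 := by omega
    refine ⟨e, ?_⟩
    rw [e] at hx hv
    have a3 : (j.1 : ℝ) * δ < ((i.1 : ℝ) + 1) * δ := by linarith
    have b3 := lt_of_mul_lt_mul_right a3 hδ.le
    norm_cast at b3
    omega
  intro i j h
  have h1 := key i j h.le
  have h2 := key j i h.ge
  ext <;> omega

/-! The proof is the high-low method carried out in physical space, without Fourier analysis. Put `N
= 1/Δ` and `w = Δ ^ k`, and let `D` be the set of `w`-squares meeting the refined set of squares.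
For a line `y = a x + b`, compare the number of squares of `D` at vertical height at most `24 w`
from it with the number at height at most `N w`, each divided by the length of its window. If a
`w`-tube is much richer than its parent of width `N w`, relative to the expected counts, then the
fine term dominates on the whole parameter cell of the tube. The sum of the squared incidence counts
of such tubes is therefore bounded by the second moment of the difference.

Expanding this second moment gives a sum over pairs of squares. The difference kernel has mean zero,
so integration against a Lipschitz cutoff in the slope gains a second power of decay in the offset
(`abs_offsetCorr_le_of_ne`). At lattice offset `(i, j)` the pair contributes at most a constant
times `(N / w) / (max 1 |i| * max 1 |j|)`, and summing over `j` and `i` costs only two logarithms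
(`sum_sq_le_of_countDiff`).

To use this at all scales, first pass to squares whose fibres at every scale have comparable size
(`exists_uniform_subset`). Call a tube bad if its richness exceeds a threshold `lam` and also
exceeds `192 H` times that of its parent. Deleting every `δ`-tube with a bad ancestor leaves tubes
whose richness, starting from at most `1` at scale `1`, is at most `(192 H) ^ n * lam` at every
scale. The deletion is affordable by `sum_card_bad_le`: the second moment bounds the incidences of
bad tubes at scale `w`, the two `(δ, ·, C)` conditions convert them into incidences at scale `δ`,
and the resulting factor `w ^ (s + t - 2)` is at most `1`. The threshold `lam` makes the total loss
at most half of all incidences. The bound on the number of tubes follows by double counting at scale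
`δ`. -/

namespace HighLow
open MeasureTheory

/-! ### Averaging kernels on the line and the autocorrelation of their difference -/

/-- The normalised indicator function of `[-ρ, ρ]`. -/
noncomputable def box (ρ : ℝ) : ℝ → ℝ := Set.indicator (Set.Icc (-ρ) ρ) (fun _ => 1 / (2 * ρ))

theorem box_of_le {ρ u : ℝ} (h : |u| ≤ ρ) : box ρ u = 1 / (2 * ρ) :=
  Set.indicator_of_mem (Set.mem_Icc.2 (abs_le.1 h)) _

theorem box_of_lt {ρ u : ℝ} (h : ρ < |u|) : box ρ u = 0 :=
  Set.indicator_of_notMem (fun h' => absurd (abs_le.2 (Set.mem_Icc.1 h')) (not_le.2 h)) _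

theorem box_neg (ρ u : ℝ) : box ρ (-u) = box ρ u := by
  rcases le_or_gt |u| ρ with h | h
  · rw [box_of_le h, box_of_le (by rwa [abs_neg])]
  · rw [box_of_lt h, box_of_lt (by rwa [abs_neg])]

theorem box_nonneg {ρ : ℝ} (hρ : 0 < ρ) (u : ℝ) : 0 ≤ box ρ u :=
  Set.indicator_nonneg (fun _ _ => by positivity) u

theorem box_le {ρ : ℝ} (hρ : 0 < ρ) (u : ℝ) : box ρ u ≤ 1 / (2 * ρ) :=
  Set.indicator_le_self' (fun _ _ => by positivity) u

theorem measurable_box (ρ : ℝ) : Measurable (box ρ) :=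
  measurable_const.indicator measurableSet_Icc

theorem integrable_box (ρ : ℝ) : Integrable (box ρ) := by
  rw [box, integrable_indicator_iff measurableSet_Icc]
  exact integrableOn_const (by simp)

theorem integral_box {ρ : ℝ} (hρ : 0 < ρ) : ∫ u, box ρ u = 1 := by
  rw [box, integral_indicator measurableSet_Icc, setIntegral_const, smul_eq_mul,
    Measure.real, Real.volume_Icc, ENNReal.toReal_ofReal (by linarith)]
  field_simp
  ring

/-- The difference of the averages at the scales `ρ₁` and `ρ₂`. -/
noncomputable def boxDiff (ρ₁ ρ₂ u : ℝ) : ℝ := box ρ₁ u - box ρ₂ u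

section
variable {ρ₁ ρ₂ : ℝ}

theorem measurable_boxDiff : Measurable (boxDiff ρ₁ ρ₂) :=
  (measurable_box ρ₁).sub (measurable_box ρ₂)

theorem integrable_boxDiff : Integrable (boxDiff ρ₁ ρ₂) :=
  (integrable_box ρ₁).sub (integrable_box ρ₂)

theorem boxDiff_neg (u : ℝ) : boxDiff ρ₁ ρ₂ (-u) = boxDiff ρ₁ ρ₂ u := by
  simp only [boxDiff, box_neg]

theorem integral_boxDiff (h₁ : 0 < ρ₁) (h₂ : 0 < ρ₂) : ∫ u, boxDiff ρ₁ ρ₂ u = 0 := by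
  simp only [boxDiff]
  rw [integral_sub (integrable_box _) (integrable_box _), integral_box h₁, integral_box h₂,
    sub_self]

theorem integral_abs_boxDiff_le (h₁ : 0 < ρ₁) (h₂ : 0 < ρ₂) : ∫ u, |boxDiff ρ₁ ρ₂ u| ≤ 2 := by
  have h : ∫ u, |boxDiff ρ₁ ρ₂ u| ≤ ∫ u, (box ρ₁ u + box ρ₂ u) := by
    refine integral_mono integrable_boxDiff.abs ((integrable_box _).add (integrable_box _)) ?_
    intro u
    have a := box_nonneg h₁ u
    have b := box_nonneg h₂ u
    simp only [boxDiff]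
    exact abs_le.2 ⟨by linarith, by linarith⟩
  rw [integral_add (integrable_box _) (integrable_box _), integral_box h₁, integral_box h₂] at h
  linarith

theorem abs_boxDiff_le (h₁ : 0 < ρ₁) (h : ρ₁ ≤ ρ₂) (u : ℝ) :
    |boxDiff ρ₁ ρ₂ u| ≤ 1 / (2 * ρ₁) := by
  have h₂ : 0 < ρ₂ := h₁.trans_le h
  have a := box_nonneg h₁ u
  have b := box_nonneg h₂ u
  have a' := box_le h₁ u
  have b' := box_le h₂ u
  have : 1 / (2 * ρ₂) ≤ 1 / (2 * ρ₁) := by gcongr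
  simp only [boxDiff]
  exact abs_le.2 ⟨by linarith, by linarith⟩

theorem abs_boxDiff_le_of_lt (h₂ : 0 < ρ₂) {u : ℝ} (hu : ρ₁ < |u|) :
    |boxDiff ρ₁ ρ₂ u| ≤ 1 / (2 * ρ₂) := by
  rw [boxDiff, box_of_lt hu, zero_sub, abs_neg, abs_of_nonneg (box_nonneg h₂ u)]
  exact box_le h₂ u

theorem boxDiff_of_lt (h : ρ₁ ≤ ρ₂) {u : ℝ} (hu : ρ₂ < |u|) : boxDiff ρ₁ ρ₂ u = 0 := by
  rw [boxDiff, box_of_lt hu, box_of_lt (h.trans_lt hu), sub_self]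

/-- The autocorrelation of `boxDiff`. -/
noncomputable def boxCorr (ρ₁ ρ₂ u : ℝ) : ℝ := ∫ v, boxDiff ρ₁ ρ₂ v * boxDiff ρ₁ ρ₂ (u - v)

theorem measurable_boxCorr : Measurable (boxCorr ρ₁ ρ₂) := by
  have : StronglyMeasurable (fun z : ℝ × ℝ => boxDiff ρ₁ ρ₂ z.2 * boxDiff ρ₁ ρ₂ (z.1 - z.2)) :=
    ((measurable_boxDiff.comp measurable_snd).mul
      (measurable_boxDiff.comp (measurable_fst.sub measurable_snd))).stronglyMeasurable
  exact this.integral_prod_right.measurable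

theorem integrable_boxDiff_mul (h₁ : 0 < ρ₁) (h : ρ₁ ≤ ρ₂) (u : ℝ) :
    Integrable (fun v => boxDiff ρ₁ ρ₂ v * boxDiff ρ₁ ρ₂ (u - v)) := by
  refine integrable_boxDiff.mul_bdd (c := 1 / (2 * ρ₁)) ?_ ?_
  · exact (measurable_boxDiff.comp (measurable_const.sub measurable_id)).aestronglyMeasurable
  · exact Filter.Eventually.of_forall fun v => abs_boxDiff_le h₁ h _

theorem integral_boxDiff_mul_boxDiff (α β : ℝ) :
    ∫ b, boxDiff ρ₁ ρ₂ (α - b) * boxDiff ρ₁ ρ₂ (β - b) = boxCorr ρ₁ ρ₂ (α - β) := by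
  rw [boxCorr, ← integral_sub_left_eq_self _ volume α]
  congr 1
  ext b
  rw [sub_sub_cancel, ← boxDiff_neg (β - (α - b))]
  ring_nf

theorem integrable_boxDiff_mul_boxDiff (h₁ : 0 < ρ₁) (h : ρ₁ ≤ ρ₂) (α β : ℝ) :
    Integrable (fun b => boxDiff ρ₁ ρ₂ (α - b) * boxDiff ρ₁ ρ₂ (β - b)) := by
  have := (integrable_boxDiff_mul h₁ h (α - β)).comp_sub_left α
  refine this.congr (Filter.Eventually.of_forall fun b => ?_)
  simp only
  rw [← boxDiff_neg (β - b)]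
  ring_nf

theorem boxCorr_of_lt (h : ρ₁ ≤ ρ₂) {u : ℝ} (hu : 2 * ρ₂ < |u|) : boxCorr ρ₁ ρ₂ u = 0 := by
  rw [boxCorr]
  refine integral_eq_zero_of_ae (Filter.Eventually.of_forall fun v => ?_)
  rcases le_or_gt |v| ρ₂ with hv | hv
  · have : ρ₂ < |u - v| := by
      have := abs_sub_abs_le_abs_sub u v
      linarith
    simp [boxDiff_of_lt h this]
  · simp [boxDiff_of_lt h hv]

theorem abs_boxCorr_le (h₁ : 0 < ρ₁) (h : ρ₁ ≤ ρ₂) (u : ℝ) : |boxCorr ρ₁ ρ₂ u| ≤ 1 / ρ₁ := by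
  have h₂ : 0 < ρ₂ := h₁.trans_le h
  have : ‖boxCorr ρ₁ ρ₂ u‖ ≤ ∫ v, |boxDiff ρ₁ ρ₂ v| * (1 / (2 * ρ₁)) := by
    refine norm_integral_le_of_norm_le (integrable_boxDiff.abs.mul_const _)
      (Filter.Eventually.of_forall fun v => ?_)
    rw [Real.norm_eq_abs, abs_mul]
    gcongr
    exact abs_boxDiff_le h₁ h _
  rw [integral_mul_const, Real.norm_eq_abs] at this
  calc _ ≤ _ := this
    _ ≤ 2 * (1 / (2 * ρ₁)) := by gcongr; exact integral_abs_boxDiff_le h₁ h₂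
    _ = 1 / ρ₁ := by field_simp

/-- For `|u| > 2 ρ₁` one of `v` and `u - v` lies outside `[-ρ₁, ρ₁]`, where the narrow box vanishes
and the difference is at most `1 / (2 ρ₂)`. The other factor is absorbed by its `L¹` norm. -/
theorem abs_boxCorr_le_of_lt (h₁ : 0 < ρ₁) (h : ρ₁ ≤ ρ₂) {u : ℝ} (hu : 2 * ρ₁ < |u|) :
    |boxCorr ρ₁ ρ₂ u| ≤ 2 / ρ₂ := by
  have h₂ : 0 < ρ₂ := h₁.trans_le h
  have hi : Integrable fun v => |boxDiff ρ₁ ρ₂ v| * (1 / (2 * ρ₂)) :=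
    integrable_boxDiff.abs.mul_const _
  have hi' : Integrable fun v => |boxDiff ρ₁ ρ₂ (u - v)| * (1 / (2 * ρ₂)) := hi.comp_sub_left u
  have : ‖boxCorr ρ₁ ρ₂ u‖ ≤
      ∫ v, (|boxDiff ρ₁ ρ₂ v| * (1 / (2 * ρ₂)) + |boxDiff ρ₁ ρ₂ (u - v)| * (1 / (2 * ρ₂))) := by
    refine norm_integral_le_of_norm_le (hi.add hi') (Filter.Eventually.of_forall fun v => ?_)
    rw [Real.norm_eq_abs, abs_mul]
    rcases le_or_gt |v| ρ₁ with hv | hv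
    · have : ρ₁ < |u - v| := by
        have := abs_sub_abs_le_abs_sub u v
        linarith
      have h3 := mul_le_mul_of_nonneg_left (abs_boxDiff_le_of_lt h₂ this)
        (abs_nonneg (boxDiff ρ₁ ρ₂ v))
      have h4 : 0 ≤ |boxDiff ρ₁ ρ₂ (u - v)| * (1 / (2 * ρ₂)) := by positivity
      linarith
    · have h3 := mul_le_mul_of_nonneg_right (abs_boxDiff_le_of_lt h₂ hv)
        (abs_nonneg (boxDiff ρ₁ ρ₂ (u - v)))
      have h4 : 0 ≤ |boxDiff ρ₁ ρ₂ v| * (1 / (2 * ρ₂)) := by positivity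
      linarith
  rw [integral_add hi hi',
    integral_sub_left_eq_self (fun v => |boxDiff ρ₁ ρ₂ v| * (1 / (2 * ρ₂))) volume u,
    integral_mul_const, Real.norm_eq_abs] at this
  have h3 := mul_le_mul_of_nonneg_right (integral_abs_boxDiff_le h₁ h₂)
    (show 0 ≤ 1 / (2 * ρ₂) by positivity)
  have h4 : 2 * (1 / (2 * ρ₂)) + 2 * (1 / (2 * ρ₂)) = 2 / ρ₂ := by field_simp; ring
  linarith

theorem abs_boxCorr_mul_sq_le (h₁ : 0 < ρ₁) (h : ρ₁ ≤ ρ₂) (u : ℝ) :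
    |boxCorr ρ₁ ρ₂ u| * u ^ 2 ≤ 8 * ρ₂ := by
  have h₂ : 0 < ρ₂ := h₁.trans_le h
  have sq : ∀ c : ℝ, |u| ≤ c → u ^ 2 ≤ c ^ 2 := fun c hc => by
    rw [← sq_abs u]; gcongr
  rcases le_or_gt |u| (2 * ρ₁) with hu | hu
  · calc _ ≤ 1 / ρ₁ * (2 * ρ₁) ^ 2:=
          mul_le_mul (abs_boxCorr_le h₁ h u) (sq _ hu) (sq_nonneg _) (by positivity)
      _ = 4 * ρ₁ := by field_simp; ring
      _ ≤ _ := by linarith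
  rcases le_or_gt |u| (2 * ρ₂) with hu' | hu'
  · calc _ ≤ 2 / ρ₂ * (2 * ρ₂) ^ 2:=
          mul_le_mul (abs_boxCorr_le_of_lt h₁ h hu) (sq _ hu') (sq_nonneg _) (by positivity)
      _ = 8 * ρ₂ := by field_simp; ring
  · rw [boxCorr_of_lt h hu']
    simp only [abs_zero, zero_mul]
    positivity

theorem boxCorr_eq_convolution :
    boxCorr ρ₁ ρ₂ = convolution (boxDiff ρ₁ ρ₂) (boxDiff ρ₁ ρ₂) (ContinuousLinearMap.mul ℝ ℝ)
      volume := rfl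

theorem integrable_boxCorr : Integrable (boxCorr ρ₁ ρ₂) := by
  rw [boxCorr_eq_convolution]
  exact integrable_boxDiff.integrable_convolution _ integrable_boxDiff

/-- This is the cancellation behind the high-low gain: the autocorrelation inherits mean zero from
the difference of two averages. -/
theorem integral_boxCorr (h₁ : 0 < ρ₁) (h₂ : 0 < ρ₂) : ∫ u, boxCorr ρ₁ ρ₂ u = 0 := by
  rw [boxCorr_eq_convolution, integral_convolution _ integrable_boxDiff integrable_boxDiff,
    integral_boxDiff h₁ h₂]
  simp

theorem integral_abs_boxCorr_le (h₁ : 0 < ρ₁) (h₂ : 0 < ρ₂) :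
    ∫ u, |boxCorr ρ₁ ρ₂ u| ≤ 4 := by
  have hi : Integrable fun v => |boxDiff ρ₁ ρ₂ v| := integrable_boxDiff.abs
  have : ∫ u, |boxCorr ρ₁ ρ₂ u| ≤ ∫ u, convolution (fun v => |boxDiff ρ₁ ρ₂ v|)
      (fun v => |boxDiff ρ₁ ρ₂ v|) (ContinuousLinearMap.mul ℝ ℝ) volume u := by
    refine integral_mono integrable_boxCorr.abs (hi.integrable_convolution _ hi) fun u => ?_
    refine (abs_integral_le_integral_abs).trans_eq ?_
    simp only [abs_mul]
    rfl
  rw [integral_convolution _ hi hi] at this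
  have h3 := integral_abs_boxDiff_le h₁ h₂
  have h4 : 0 ≤ ∫ u, |boxDiff ρ₁ ρ₂ u| := integral_nonneg fun _ => abs_nonneg _
  simp only [ContinuousLinearMap.mul_apply'] at this
  nlinarith

/-! ### Integration over slopes: decay of the correlation in the offset -/

/-- A Lipschitz cutoff function that is at least `1` on `[-2, 2]`. -/
noncomputable def slopeCutoff (a : ℝ) : ℝ := max 0 (3 - |a|)

theorem slopeCutoff_nonneg (a : ℝ) : 0 ≤ slopeCutoff a := le_max_left _ _

theorem one_le_slopeCutoff {a : ℝ} (h : |a| ≤ 2) : 1 ≤ slopeCutoff a :=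
  le_max_of_le_right (by linarith)

theorem slopeCutoff_of_lt {a : ℝ} (h : 3 < |a|) : slopeCutoff a = 0 :=
  max_eq_left (by linarith)

theorem abs_slopeCutoff_sub_le (a b : ℝ) : |slopeCutoff a - slopeCutoff b| ≤ |a - b| := by
  refine (abs_max_sub_max_le_max _ _ _ _).trans ?_
  rw [sub_self, abs_zero, show 3 - |a| - (3 - |b|) = |b| - |a| by ring, abs_sub_comm a b]
  exact max_le (abs_nonneg _) (abs_abs_sub_abs_le _ _)

theorem continuous_slopeCutoff : Continuous slopeCutoff := by
  unfold slopeCutoff; fun_prop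

theorem integrable_slopeCutoff : Integrable slopeCutoff := by
  refine continuous_slopeCutoff.integrable_of_hasCompactSupport ?_
  refine HasCompactSupport.intro (isCompact_Icc (a := (-3 : ℝ)) (b := 3)) fun a ha => ?_
  refine slopeCutoff_of_lt ?_
  by_contra h
  exact ha (abs_le.1 (not_lt.1 h))

/-- The correlation of the averages over the strips dual to two points at offset `(X, Y)`. -/
noncomputable def offsetCorr (ρ₁ ρ₂ X Y : ℝ) : ℝ :=
  ∫ a, slopeCutoff a * boxCorr ρ₁ ρ₂ (Y - a * X)

theorem integrable_slopeCutoff_mul (h₁ : 0 < ρ₁) (h : ρ₁ ≤ ρ₂) (X Y : ℝ) :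
    Integrable (fun a => slopeCutoff a * boxCorr ρ₁ ρ₂ (Y - a * X)) := by
  refine integrable_slopeCutoff.mul_bdd (c := 1 / ρ₁) ?_ ?_
  · exact (measurable_boxCorr.comp (by fun_prop)).aestronglyMeasurable
  · exact Filter.Eventually.of_forall fun v => abs_boxCorr_le h₁ h _

theorem abs_offsetCorr_le (h₁ : 0 < ρ₁) (h : ρ₁ ≤ ρ₂) (X Y : ℝ) :
    |offsetCorr ρ₁ ρ₂ X Y| ≤ (∫ a, slopeCutoff a) * (1 / ρ₁) := by
  rw [← integral_mul_const]
  rw [offsetCorr, ← Real.norm_eq_abs]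
  refine norm_integral_le_of_norm_le (integrable_slopeCutoff.mul_const _)
      (Filter.Eventually.of_forall fun a => ?_)
  rw [Real.norm_eq_abs, abs_mul, abs_of_nonneg (slopeCutoff_nonneg a)]
  gcongr
  · exact slopeCutoff_nonneg a
  · exact abs_boxCorr_le h₁ h _

/-- For slopes in the support of the cutoff, the argument `Y - a X` stays comparable to `Y`, so
pointwise decay of `boxCorr` suffices and no cancellation is needed. -/
theorem abs_offsetCorr_le_of_steep (h₁ : 0 < ρ₁) (h : ρ₁ ≤ ρ₂) {X Y : ℝ} (hY : Y ≠ 0)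
    (hXY : 4 * |X| ≤ |Y|) :
    |offsetCorr ρ₁ ρ₂ X Y| ≤ (∫ a, slopeCutoff a) * (128 * ρ₂ / Y ^ 2) := by
  rw [← integral_mul_const]
  rw [offsetCorr, ← Real.norm_eq_abs]
  refine norm_integral_le_of_norm_le (integrable_slopeCutoff.mul_const _)
      (Filter.Eventually.of_forall fun a => ?_)
  rw [Real.norm_eq_abs, abs_mul, abs_of_nonneg (slopeCutoff_nonneg a)]
  rcases lt_or_ge 3 |a| with ha | ha
  · simp [slopeCutoff_of_lt ha]
  refine mul_le_mul_of_nonneg_left ?_ (slopeCutoff_nonneg a)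
  have hY' : 0 < Y ^ 2 := by positivity
  rw [le_div_iff₀ hY']
  have hu : |Y| / 4 ≤ |Y - a * X| := by
    have e1 := abs_sub_abs_le_abs_sub Y (a * X)
    rw [abs_mul] at e1
    nlinarith [abs_nonneg X]
  have hu2 : Y ^ 2 ≤ 16 * (Y - a * X) ^ 2 := by
    rw [← sq_abs Y, ← sq_abs (Y - a * X)]
    nlinarith [abs_nonneg Y]
  have := abs_boxCorr_mul_sq_le h₁ h (Y - a * X)
  nlinarith [abs_nonneg (boxCorr ρ₁ ρ₂ (Y - a * X))]

/-- Substituting `u = Y - a X` moves the offset into the cutoff and costs `1 / |X|`. As `boxCorr`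
has mean zero, the cutoff may be replaced by its increment between `(Y - u) / X` and `Y / X`, which
is at most `2 ρ₂ / |X|` on the support. This gives the second factor `1 / |X|`. -/
theorem abs_offsetCorr_le_of_ne (h₁ : 0 < ρ₁) (h : ρ₁ ≤ ρ₂) {X : ℝ} (hX : X ≠ 0) (Y : ℝ) :
    |offsetCorr ρ₁ ρ₂ X Y| ≤ 8 * ρ₂ / X ^ 2 := by
  have h₂ : 0 < ρ₂ := h₁.trans_le h
  have hsub : offsetCorr ρ₁ ρ₂ X Y =
      |X⁻¹| * ∫ u, slopeCutoff ((Y - u) / X) * boxCorr ρ₁ ρ₂ u := by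
    have e1 := integral_sub_left_eq_self
      (fun u => slopeCutoff ((Y - u) / X) * boxCorr ρ₁ ρ₂ u) volume Y
    have e2 := Measure.integral_comp_mul_right
      (fun u => slopeCutoff (u / X) * boxCorr ρ₁ ρ₂ (Y - u)) X
    simp only [sub_sub_cancel] at e1
    rw [e1, smul_eq_mul] at e2
    rw [← e2, offsetCorr]
    congr 1
    ext a
    rw [mul_div_cancel_right₀ _ hX]
  have hint : Integrable fun u => slopeCutoff ((Y - u) / X) * boxCorr ρ₁ ρ₂ u := by
    refine integrable_boxCorr.bdd_mul (c := 3) ?_ ?_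
    · exact (continuous_slopeCutoff.comp (by fun_prop)).aestronglyMeasurable
    · refine Filter.Eventually.of_forall fun u => ?_
      rw [Real.norm_eq_abs, abs_of_nonneg (slopeCutoff_nonneg _)]
      exact max_le (by norm_num) (by linarith [abs_nonneg ((Y - u) / X)])
  have hzero : ∫ u, slopeCutoff ((Y - u) / X) * boxCorr ρ₁ ρ₂ u =
      ∫ u, (slopeCutoff ((Y - u) / X) - slopeCutoff (Y / X)) * boxCorr ρ₁ ρ₂ u := by
    simp only [sub_mul]
    rw [integral_sub hint (integrable_boxCorr.const_mul _), integral_const_mul,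
      integral_boxCorr h₁ h₂]
    ring
  have hbd : |∫ u, slopeCutoff ((Y - u) / X) * boxCorr ρ₁ ρ₂ u| ≤ 8 * ρ₂ / |X| := by
    rw [hzero]
    have : ‖∫ u, (slopeCutoff ((Y - u) / X) - slopeCutoff (Y / X)) * boxCorr ρ₁ ρ₂ u‖ ≤
        ∫ u, (2 * ρ₂ / |X|) * |boxCorr ρ₁ ρ₂ u| := by
      refine norm_integral_le_of_norm_le (integrable_boxCorr.abs.const_mul _)
        (Filter.Eventually.of_forall fun u => ?_)
      rw [Real.norm_eq_abs, abs_mul]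
      rcases le_or_gt |u| (2 * ρ₂) with hu | hu
      · refine mul_le_mul_of_nonneg_right ?_ (abs_nonneg _)
        refine (abs_slopeCutoff_sub_le _ _).trans ?_
        rw [← sub_div, abs_div, sub_sub_cancel_left, abs_neg]
        gcongr
      · simp [boxCorr_of_lt h hu]
    rw [integral_const_mul, Real.norm_eq_abs] at this
    have h4 := mul_le_mul_of_nonneg_left (integral_abs_boxCorr_le h₁ h₂)
      (show 0 ≤ 2 * ρ₂ / |X| by positivity)
    calc _ ≤ _ := this
      _ ≤ _ := h4
      _ = _ := by ring
  rw [hsub, abs_mul, abs_abs, abs_inv]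
  calc |X|⁻¹ * _ ≤ |X|⁻¹ * (8 * ρ₂ / |X|) := by gcongr
    _ = 8 * ρ₂ / |X| ^ 2 := by field_simp
    _ = _ := by rw [sq_abs]

end
-- The second moment of the count difference over lines
open MeasureTheory

/-- The indicator function of the cell `[i w, (i + 1) w)`. -/
noncomputable def cell (w : ℝ) (i : ℤ) : ℝ → ℝ :=
  Set.indicator (Set.Ico (i * w) ((i + 1) * w)) (fun _ => 1)

theorem cell_nonneg (w : ℝ) (i : ℤ) (u : ℝ) : 0 ≤ cell w i u :=
  Set.indicator_nonneg (fun _ _ => zero_le_one) u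

theorem integrable_cell (w : ℝ) (i : ℤ) : Integrable (cell w i) := by
  rw [cell, integrable_indicator_iff measurableSet_Ico]
  exact integrableOn_const (by simp)

theorem integral_cell {w : ℝ} (hw : 0 < w) (i : ℤ) : ∫ u, cell w i u = w := by
  rw [cell, integral_indicator measurableSet_Ico, setIntegral_const, smul_eq_mul,
    Measure.real, Real.volume_Ico, ENNReal.toReal_ofReal (by linarith)]
  ring

theorem cell_of_mem {w : ℝ} {i : ℤ} {u : ℝ} (h₁ : i * w ≤ u) (h₂ : u < (i + 1) * w) :
    cell w i u = 1 :=
  Set.indicator_of_mem (Set.mem_Ico.2 ⟨h₁, h₂⟩) _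

theorem mem_cell_of_ne {w : ℝ} {i : ℤ} {u : ℝ} (h : cell w i u ≠ 0) :
    i * w ≤ u ∧ u < (i + 1) * w :=
  Set.mem_Ico.1 (Set.mem_of_indicator_ne_zero h)

theorem eq_floor_of_mem_cell {w : ℝ} (hw : 0 < w) {i : ℤ} {u : ℝ} (h₁ : i * w ≤ u)
    (h₂ : u < (i + 1) * w) : i = ⌊u / w⌋ := by
  rw [eq_comm, Int.floor_eq_iff, le_div_iff₀ hw, div_lt_iff₀ hw]
  exact ⟨h₁, h₂⟩

section
variable {ρ₁ ρ₂ w : ℝ}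

/-- The difference at the line `y = a x + b` of the normalised counts of lattice points in its
vertical neighbourhoods of heights `ρ₁` and `ρ₂`. -/
noncomputable def countDiff (ρ₁ ρ₂ w : ℝ) (D : Finset (ℤ × ℤ)) (a b : ℝ) : ℝ :=
  ∑ Q ∈ D, boxDiff ρ₁ ρ₂ (Q.2 * w - a * (Q.1 * w) - b)

theorem countDiff_sq (D : Finset (ℤ × ℤ)) (a b : ℝ) :
    countDiff ρ₁ ρ₂ w D a b ^ 2 = ∑ Q ∈ D, ∑ Q' ∈ D,
      boxDiff ρ₁ ρ₂ (Q.2 * w - a * (Q.1 * w) - b) *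
        boxDiff ρ₁ ρ₂ (Q'.2 * w - a * (Q'.1 * w) - b) := by
  rw [countDiff, sq, Finset.sum_mul_sum]

theorem integrable_countDiff_sq (h₁ : 0 < ρ₁) (h : ρ₁ ≤ ρ₂) (D : Finset (ℤ × ℤ)) (a : ℝ) :
    Integrable fun b => countDiff ρ₁ ρ₂ w D a b ^ 2 := by
  simp only [countDiff_sq]
  exact integrable_finsetSum _ fun Q _ => integrable_finsetSum _ fun Q' _ =>
    integrable_boxDiff_mul_boxDiff h₁ h _ _

theorem integral_countDiff_sq (h₁ : 0 < ρ₁) (h : ρ₁ ≤ ρ₂) (D : Finset (ℤ × ℤ)) (a : ℝ) :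
    ∫ b, countDiff ρ₁ ρ₂ w D a b ^ 2 = ∑ Q ∈ D, ∑ Q' ∈ D,
      boxCorr ρ₁ ρ₂ ((Q.2 * w - Q'.2 * w) - a * (Q.1 * w - Q'.1 * w)) := by
  simp only [countDiff_sq]
  rw [integral_finsetSum _ fun Q _ => integrable_finsetSum _ fun Q' _ =>
    integrable_boxDiff_mul_boxDiff h₁ h _ _]
  refine Finset.sum_congr rfl fun Q _ => ?_
  rw [integral_finsetSum _ fun Q' _ => integrable_boxDiff_mul_boxDiff h₁ h _ _]
  refine Finset.sum_congr rfl fun Q' _ => ?_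
  rw [integral_boxDiff_mul_boxDiff]
  congr 1
  ring

/-- The second moment of `countDiff` controls its values on a family of cells. -/
theorem sum_sq_le_sum_offsetCorr (h₁ : 0 < ρ₁) (h : ρ₁ ≤ ρ₂) (hw : 0 < w)
    (D 𝒲 : Finset (ℤ × ℤ)) (c : ℤ × ℤ → ℝ) (hc : ∀ W ∈ 𝒲, 0 ≤ c W)
    (hslope : ∀ W ∈ 𝒲, -2 ≤ W.1 * w ∧ (W.1 + 1) * w ≤ 2)
    (hG : ∀ W ∈ 𝒲, ∀ a b : ℝ, W.1 * w ≤ a → a < (W.1 + 1) * w → W.2 * w ≤ b →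
      b < (W.2 + 1) * w → c W ≤ countDiff ρ₁ ρ₂ w D a b) :
    ∑ W ∈ 𝒲, w ^ 2 * c W ^ 2 ≤
      ∑ Q ∈ D, ∑ Q' ∈ D, offsetCorr ρ₁ ρ₂ (Q.1 * w - Q'.1 * w) (Q.2 * w - Q'.2 * w) := by
  -- The cells are disjoint, so at most one term is nonzero: that of the cell containing `(a, b)`.
  have pt : ∀ a b, ∑ W ∈ 𝒲, cell w W.1 a * c W ^ 2 * cell w W.2 b ≤
      countDiff ρ₁ ρ₂ w D a b ^ 2 := by
    intro a b
    by_cases hW : (⌊a / w⌋, ⌊b / w⌋) ∈ 𝒲 ∧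
      cell w ⌊a / w⌋ a * c (⌊a / w⌋, ⌊b / w⌋) ^ 2 * cell w ⌊b / w⌋ b ≠ 0
    · rw [Finset.sum_eq_single_of_mem _ hW.1]
      · obtain ⟨hW, hne⟩ := hW
        obtain ⟨ha, hb⟩ := mul_ne_zero_iff.1 hne
        obtain ⟨ha1, ha2⟩ := mem_cell_of_ne (mul_ne_zero_iff.1 ha).1
        obtain ⟨hb1, hb2⟩ := mem_cell_of_ne hb
        rw [cell_of_mem ha1 ha2, cell_of_mem hb1 hb2, one_mul, mul_one]
        exact pow_le_pow_left₀ (hc _ hW) (hG _ hW a b ha1 ha2 hb1 hb2) 2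
      · intro W _ hne
        by_contra h0
        obtain ⟨ha, hb⟩ := mul_ne_zero_iff.1 h0
        obtain ⟨ha1, ha2⟩ := mem_cell_of_ne (mul_ne_zero_iff.1 ha).1
        obtain ⟨hb1, hb2⟩ := mem_cell_of_ne hb
        exact hne (Prod.ext (eq_floor_of_mem_cell hw ha1 ha2) (eq_floor_of_mem_cell hw hb1 hb2))
    · rw [Finset.sum_eq_zero]
      · exact sq_nonneg _
      · intro W hWm
        by_contra h0
        obtain ⟨ha, hb⟩ := mul_ne_zero_iff.1 h0
        obtain ⟨ha1, ha2⟩ := mem_cell_of_ne (mul_ne_zero_iff.1 ha).1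
        obtain ⟨hb1, hb2⟩ := mem_cell_of_ne hb
        have e : W = (⌊a / w⌋, ⌊b / w⌋) :=
          Prod.ext (eq_floor_of_mem_cell hw ha1 ha2) (eq_floor_of_mem_cell hw hb1 hb2)
        refine hW ⟨e ▸ hWm, ?_⟩
        rw [e] at h0
        exact h0
  have hJ : ∀ a, ∑ W ∈ 𝒲, cell w W.1 a * (w * c W ^ 2) ≤ ∑ Q ∈ D, ∑ Q' ∈ D,
      boxCorr ρ₁ ρ₂ ((Q.2 * w - Q'.2 * w) - a * (Q.1 * w - Q'.1 * w)) := by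
    intro a
    rw [← integral_countDiff_sq h₁ h]
    have := integral_mono (integrable_finsetSum 𝒲 fun W _ =>
      (integrable_cell w W.2).const_mul (cell w W.1 a * c W ^ 2))
      (integrable_countDiff_sq h₁ h D a) (pt a)
    rw [integral_finsetSum _ fun W _ =>
      (integrable_cell w W.2).const_mul (cell w W.1 a * c W ^ 2)] at this
    simp only [integral_const_mul, integral_cell hw] at this
    refine le_trans (le_of_eq (Finset.sum_congr rfl fun W _ => ?_)) this
    ring
  -- The cutoff may be inserted because it is at least `1` on the slopes of the cells and the
  -- integrated square on the right is nonnegative.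
  have hη : ∀ a, ∑ W ∈ 𝒲, (w * c W ^ 2) * cell w W.1 a ≤ ∑ Q ∈ D, ∑ Q' ∈ D, slopeCutoff a *
      boxCorr ρ₁ ρ₂ ((Q.2 * w - Q'.2 * w) - a * (Q.1 * w - Q'.1 * w)) := by
    intro a
    simp only [← Finset.mul_sum]
    refine le_trans ?_ (mul_le_mul_of_nonneg_left (hJ a) (slopeCutoff_nonneg a))
    rw [Finset.mul_sum]
    refine Finset.sum_le_sum fun W hWm => ?_
    by_cases h0 : cell w W.1 a = 0
    · simp [h0]
    · obtain ⟨ha1, ha2⟩ := mem_cell_of_ne h0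
      obtain ⟨hs1, hs2⟩ := hslope W hWm
      have h1 := one_le_slopeCutoff (abs_le.2 ⟨hs1.trans ha1, (ha2.trans_le hs2).le⟩)
      have h2 : 0 ≤ cell w W.1 a * (w * c W ^ 2) :=
        mul_nonneg (cell_nonneg _ _ _) (by positivity)
      nlinarith
  have hiR : ∀ Q Q' : ℤ × ℤ, Integrable fun a => slopeCutoff a *
      boxCorr ρ₁ ρ₂ ((Q.2 * w - Q'.2 * w) - a * (Q.1 * w - Q'.1 * w)) := fun Q Q' =>
    integrable_slopeCutoff_mul h₁ h _ _
  have hfin := integral_mono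
    (integrable_finsetSum 𝒲 fun W _ => (integrable_cell w W.1).const_mul (w * c W ^ 2))
    (integrable_finsetSum D fun Q _ => integrable_finsetSum D fun Q' _ => hiR Q Q') hη
  rw [integral_finsetSum _ fun W _ => (integrable_cell w W.1).const_mul (w * c W ^ 2),
    integral_finsetSum _ fun Q _ => integrable_finsetSum D fun Q' _ => hiR Q Q'] at hfin
  simp only [integral_const_mul, integral_cell hw] at hfin
  refine le_trans (le_of_eq (Finset.sum_congr rfl fun W _ => by ring)) (hfin.trans_eq ?_)
  refine Finset.sum_congr rfl fun Q _ => ?_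
  rw [integral_finsetSum _ fun Q' _ => hiR Q Q']
  rfl

/-- The constant in `abs_offsetCorr_lattice_le`. -/
noncomputable def corrConst : ℝ := 512 * (∫ a, slopeCutoff a) + 32

theorem integral_slopeCutoff_nonneg : 0 ≤ ∫ a, slopeCutoff a :=
  integral_nonneg slopeCutoff_nonneg

theorem corrConst_pos : 0 < corrConst := by
  have := integral_slopeCutoff_nonneg
  unfold corrConst; linarith

/-- The three regimes (zero offset, steep offset, the rest) are put in one product form, which makes
the double sum over the lattice factor into two harmonic sums. -/
theorem abs_offsetCorr_lattice_le (h₁ : 0 < ρ₁) (h : ρ₁ ≤ ρ₂) (hw : 0 < w) (hwρ : w ≤ ρ₁)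
    (i j : ℤ) :
    |offsetCorr ρ₁ ρ₂ (i * w) (j * w)| ≤
      corrConst * (ρ₂ / w ^ 2) * ((1 / max 1 |(i : ℝ)|) * (1 / max 1 |(j : ℝ)|)) := by
  have h₂ : 0 < ρ₂ := h₁.trans_le h
  have hI := integral_slopeCutoff_nonneg
  have one_le : ∀ k : ℤ, k ≠ 0 → 1 ≤ |(k : ℝ)| := fun k hk => by
    exact_mod_cast Int.one_le_abs hk
  -- Here `x` will be `1`, `j ^ 2` or `i ^ 2`. The factor `4` is the ratio separating steep offsets
  -- from the others.
  have key : ∀ x K : ℝ, 1 ≤ x → max 1 |(i : ℝ)| * max 1 |(j : ℝ)| ≤ 4 * x → 0 ≤ K →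
      4 * K ≤ corrConst → K * (ρ₂ / (w ^ 2 * x)) ≤
      corrConst * (ρ₂ / w ^ 2) * ((1 / max 1 |(i : ℝ)|) * (1 / max 1 |(j : ℝ)|)) := by
    intro x K hx hm hK hC
    have hm0 : 0 < max 1 |(i : ℝ)| * max 1 |(j : ℝ)| := by positivity
    have e : K * (ρ₂ / (w ^ 2 * x)) = (4 * K) * (ρ₂ / w ^ 2) * (1 / (4 * x)) := by
      field_simp
    rw [e, one_div_mul_one_div]
    gcongr
    exact mul_nonneg corrConst_pos.le (by positivity)
  rcases le_or_gt (4 * |(i : ℝ)|) |(j : ℝ)| with hij | hij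
  · by_cases hj : j = 0
    · have hi : i = 0 := by
        by_contra hi
        have := one_le i hi
        simp only [hj, Int.cast_zero, abs_zero] at hij
        linarith
      refine le_trans ?_ (key 1 (∫ a, slopeCutoff a) le_rfl (by simp [hi, hj]) hI
        (by unfold corrConst; linarith))
      refine (abs_offsetCorr_le h₁ h _ _).trans (mul_le_mul_of_nonneg_left ?_ hI)
      rw [mul_one, div_le_div_iff₀ h₁ (by positivity)]
      nlinarith
    · have hj1 := one_le j hj
      refine le_trans ?_ (key ((j : ℝ) ^ 2) (128 * ∫ a, slopeCutoff a) ?_ ?_ (by positivity)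
        (by unfold corrConst; linarith))
      · refine (abs_offsetCorr_le_of_steep h₁ h (Y := j * w) ?_ ?_).trans (le_of_eq ?_)
        · exact mul_ne_zero (by exact_mod_cast hj) hw.ne'
        · rw [abs_mul, abs_mul, ← mul_assoc]
          gcongr
        · rw [mul_pow]
          ring
      · rw [← sq_abs]; nlinarith
      · rw [max_eq_right hj1, ← sq_abs (j : ℝ)]
        have : max 1 |(i : ℝ)| ≤ |(j : ℝ)| :=
          max_le hj1 (by linarith [abs_nonneg (i : ℝ)])
        nlinarith
  · have hi : i ≠ 0 := by
      rintro rfl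
      simp only [Int.cast_zero, abs_zero, mul_zero] at hij
      linarith [abs_nonneg (j : ℝ)]
    have hi1 := one_le i hi
    refine le_trans ?_ (key ((i : ℝ) ^ 2) 8 ?_ ?_ (by positivity)
      (by unfold corrConst; linarith))
    · refine (abs_offsetCorr_le_of_ne h₁ h (X := i * w) ?_ _).trans (le_of_eq ?_)
      · exact mul_ne_zero (by exact_mod_cast hi) hw.ne'
      · rw [mul_pow]
        ring
    · rw [← sq_abs]; nlinarith
    · rw [max_eq_right hi1, ← sq_abs (i : ℝ)]
      have : max 1 |(j : ℝ)| ≤ 4 * |(i : ℝ)| := max_le (by linarith) hij.le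
      nlinarith

theorem sum_range_one_div_max_le (R : ℕ) (hR : 1 ≤ R) :
    ∑ d ∈ Finset.range R, 1 / max 1 (d : ℝ) ≤ 2 + Real.log R := by
  obtain ⟨r, rfl⟩ := Nat.exists_eq_add_of_le' hR
  rw [Finset.sum_range_succ']
  have e : ∑ d ∈ Finset.range r, 1 / max 1 ((d + 1 : ℕ) : ℝ) = (harmonic r : ℝ) := by
    rw [harmonic]
    push_cast
    refine Finset.sum_congr rfl fun d _ => ?_
    rw [max_eq_right (by linarith [Nat.cast_nonneg (α := ℝ) d]), one_div]
  rw [e]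
  have h1 := harmonic_le_one_add_log r
  have h2 : Real.log r ≤ Real.log ((r + 1 : ℕ) : ℝ) := by
    rcases Nat.eq_zero_or_pos r with rfl | hr
    · simp
    · exact Real.log_le_log (by exact_mod_cast hr) (by push_cast; linarith)
  simp only [Nat.cast_zero, zero_le_one, max_eq_left, ne_eq, one_ne_zero, not_false_eq_true,
    div_self]
  linarith

theorem sum_Ico_one_div_max_le (R : ℕ) (hR : 1 ≤ R) {i₀ : ℤ} (hi₀ : i₀ ∈ Finset.Ico (0 : ℤ) R) :
    ∑ i ∈ Finset.Ico (0 : ℤ) R, 1 / max 1 |((i₀ - i : ℤ) : ℝ)| ≤ 2 * (2 + Real.log R) := by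
  have hmaps : ∀ i ∈ Finset.Ico (0 : ℤ) R, (i₀ - i).natAbs ∈ Finset.range R := by
    intro i hi
    rw [Finset.mem_Ico] at hi hi₀
    rw [Finset.mem_range]
    omega
  rw [← Finset.sum_fiberwise_of_maps_to hmaps]
  refine le_trans ?_ (mul_le_mul_of_nonneg_left (sum_range_one_div_max_le R hR) zero_le_two)
  rw [Finset.mul_sum]
  refine Finset.sum_le_sum fun d _ => ?_
  -- Each distance `d` from `i₀` is attained at most twice.
  have hcard : (({i ∈ Finset.Ico (0 : ℤ) R | (i₀ - i).natAbs = d}).card : ℝ) ≤ 2 := by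
    have hsub : {i ∈ Finset.Ico (0 : ℤ) R | (i₀ - i).natAbs = d} ⊆ {i₀ - d, i₀ + d} := by
      intro i hi
      have := (Finset.mem_filter.1 hi).2
      rw [Finset.mem_insert, Finset.mem_singleton]
      omega
    exact_mod_cast (Finset.card_le_card hsub).trans Finset.card_le_two
  calc _ = ∑ i ∈ Finset.Ico (0 : ℤ) R with (i₀ - i).natAbs = d, 1 / max 1 (d : ℝ) := by
        refine Finset.sum_congr rfl fun i hi => ?_
        rw [← (Finset.mem_filter.1 hi).2, Nat.cast_natAbs, Int.cast_abs]
    _ ≤ _ := by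
        rw [Finset.sum_const, nsmul_eq_mul]
        gcongr

/-- The high-low estimate: on cells where the fine count dominates the coarse count, the fine
counts are bounded in mean square. -/
theorem sum_sq_le_of_countDiff (h₁ : 0 < ρ₁) (h : ρ₁ ≤ ρ₂) (hw : 0 < w) (hwρ : w ≤ ρ₁)
    (R : ℕ) (hR : 1 ≤ R) (D 𝒲 : Finset (ℤ × ℤ))
    (hD : ∀ Q ∈ D, Q.1 ∈ Finset.Ico (0 : ℤ) R ∧ Q.2 ∈ Finset.Ico (0 : ℤ) R)
    (c : ℤ × ℤ → ℝ) (hc : ∀ W ∈ 𝒲, 0 ≤ c W)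
    (hslope : ∀ W ∈ 𝒲, -2 ≤ W.1 * w ∧ (W.1 + 1) * w ≤ 2)
    (hG : ∀ W ∈ 𝒲, ∀ a b : ℝ, W.1 * w ≤ a → a < (W.1 + 1) * w → W.2 * w ≤ b →
      b < (W.2 + 1) * w → c W ≤ countDiff ρ₁ ρ₂ w D a b) :
    ∑ W ∈ 𝒲, w ^ 2 * c W ^ 2 ≤
      D.card * (corrConst * (ρ₂ / w ^ 2) * (2 * (2 + Real.log R)) ^ 2) := by
  have h₂ : 0 < ρ₂ := h₁.trans_le h
  have hC : 0 ≤ corrConst * (ρ₂ / w ^ 2) := mul_nonneg corrConst_pos.le (by positivity)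
  refine (sum_sq_le_sum_offsetCorr h₁ h hw D 𝒲 c hc hslope hG).trans ?_
  rw [← nsmul_eq_mul, ← Finset.sum_const]
  refine Finset.sum_le_sum fun Q hQ => ?_
  have hDsub : D ⊆ Finset.Ico (0 : ℤ) R ×ˢ Finset.Ico (0 : ℤ) R := fun Q' hQ' =>
    Finset.mem_product.2 (hD Q' hQ')
  calc _ ≤ ∑ Q' ∈ D, corrConst * (ρ₂ / w ^ 2) * ((1 / max 1 |((Q.1 - Q'.1 : ℤ) : ℝ)|) *
          (1 / max 1 |((Q.2 - Q'.2 : ℤ) : ℝ)|)) := by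
        refine Finset.sum_le_sum fun Q' _ => ?_
        have := abs_offsetCorr_lattice_le h₁ h hw hwρ (Q.1 - Q'.1) (Q.2 - Q'.2)
        rw [show (Q.1 * w - Q'.1 * w : ℝ) = ((Q.1 - Q'.1 : ℤ) : ℝ) * w by push_cast; ring,
          show (Q.2 * w - Q'.2 * w : ℝ) = ((Q.2 - Q'.2 : ℤ) : ℝ) * w by push_cast; ring]
        exact (le_abs_self _).trans this
    _ ≤ ∑ Q' ∈ Finset.Ico (0 : ℤ) R ×ˢ Finset.Ico (0 : ℤ) R, corrConst * (ρ₂ / w ^ 2) *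
          ((1 / max 1 |((Q.1 - Q'.1 : ℤ) : ℝ)|) * (1 / max 1 |((Q.2 - Q'.2 : ℤ) : ℝ)|)) :=
        Finset.sum_le_sum_of_subset_of_nonneg hDsub fun Q' _ _ => mul_nonneg hC (by positivity)
    _ = corrConst * (ρ₂ / w ^ 2) *
          ((∑ i ∈ Finset.Ico (0 : ℤ) R, 1 / max 1 |((Q.1 - i : ℤ) : ℝ)|) *
          ∑ j ∈ Finset.Ico (0 : ℤ) R, 1 / max 1 |((Q.2 - j : ℤ) : ℝ)|) := by
        rw [Finset.sum_mul_sum, ← Finset.sum_product', Finset.mul_sum]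
    _ ≤ _ := by
        rw [sq (2 * (2 + Real.log R))]
        refine mul_le_mul_of_nonneg_left ?_ hC
        refine mul_le_mul (sum_Ico_one_div_max_le R hR (hD Q hQ).1)
          (sum_Ico_one_div_max_le R hR (hD Q hQ).2)
          (Finset.sum_nonneg fun _ _ => by positivity) ?_
        have := Real.log_nonneg (show (1 : ℝ) ≤ R by exact_mod_cast hR)
        positivity

end

/-! ### Dyadic ancestors of squares and tubes -/

/-- The index of the dyadic square containing the square with index `i` whose side is `N` times
as long. -/
def anc (N : ℕ) (i : ℤ × ℤ) : ℤ × ℤ := (i.1 / N, i.2 / N)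

theorem anc_one (i : ℤ × ℤ) : anc 1 i = i := by simp [anc]

theorem anc_anc (M N : ℕ) (i : ℤ × ℤ) : anc M (anc N i) = anc (N * M) i := by
  simp [anc, Int.ediv_ediv_of_nonneg (Int.natCast_nonneg N)]

section
variable {δ : ℝ} {N : ℕ}

theorem ediv_mul_le_mul (hδ : 0 < δ) (hN : 0 < N) (i : ℤ) :
    ((i / N : ℤ) : ℝ) * (N * δ) ≤ i * δ ∧ ((i : ℝ) + 1) * δ ≤ (((i / N : ℤ) : ℝ) + 1) * (N * δ) := by
  have hN' : (0 : ℤ) < N := by exact_mod_cast hN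
  have h1 : (i / N) * N ≤ i := Int.ediv_mul_le i hN'.ne'
  have h2 : i + 1 ≤ (i / N + 1) * N := Int.lt_ediv_add_one_mul_self i hN'
  constructor
  · rw [← mul_assoc]
    gcongr
    exact_mod_cast h1
  · rw [← mul_assoc]
    gcongr
    exact_mod_cast h2

theorem dyadicSquare_subset_anc (hδ : 0 < δ) (hN : 0 < N) (i : ℤ × ℤ) :
    dyadicSquare δ i ⊆ dyadicSquare (N * δ) (anc N i) := by
  rintro x ⟨h1, h2, h3, h4⟩
  obtain ⟨a1, a2⟩ := ediv_mul_le_mul hδ hN i.1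
  obtain ⟨b1, b2⟩ := ediv_mul_le_mul hδ hN i.2
  exact ⟨a1.trans h1, h2.trans_le a2, b1.trans h3, h4.trans_le b2⟩

theorem eq_of_mem_dyadicSquare (hδ : 0 < δ) {i j : ℤ × ℤ} {x : Plane} (hi : x ∈ dyadicSquare δ i)
    (hj : x ∈ dyadicSquare δ j) : i = j := by
  obtain ⟨h1, h2, h3, h4⟩ := hi
  obtain ⟨k1, k2, k3, k4⟩ := hj
  refine Prod.ext ?_ ?_
  · rw [eq_floor_of_mem_cell hδ h1 h2, eq_floor_of_mem_cell hδ k1 k2]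
  · rw [eq_floor_of_mem_cell hδ h3 h4, eq_floor_of_mem_cell hδ k3 k4]

theorem mem_unionSquares {P : Finset (ℤ × ℤ)} {x : Plane} :
    x ∈ unionSquares δ P ↔ ∃ p ∈ P, x ∈ dyadicSquare δ p := by
  simp [unionSquares]

theorem dyadicCover_unionSquares (hδ : 0 < δ) (hN : 0 < N) (P : Finset (ℤ × ℤ)) :
    dyadicCover (N * δ) (unionSquares δ P) = (P.image (anc N) : Finset (ℤ × ℤ)) := by
  have hw : 0 < N * δ := by positivity
  ext Q
  rw [Finset.mem_coe, Finset.mem_image]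
  constructor
  · rintro ⟨x, hx, hxP⟩
    obtain ⟨p, hp, hxp⟩ := mem_unionSquares.1 hxP
    exact ⟨p, hp, eq_of_mem_dyadicSquare hw (dyadicSquare_subset_anc hδ hN p hxp) hx⟩
  · rintro ⟨p, hp, rfl⟩
    have := corner_mem_dyadicSquare hδ p
    exact ⟨_, dyadicSquare_subset_anc hδ hN p this, mem_unionSquares.2 ⟨p, hp, this⟩⟩

theorem coveringNumber_unionSquares (hδ : 0 < δ) (hN : 0 < N) (P : Finset (ℤ × ℤ)) :
    coveringNumber (N * δ) (unionSquares δ P) = (P.image (anc N)).card := by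
  rw [coveringNumber, dyadicCover_unionSquares hδ hN, Set.ncard_coe_finset]

theorem coveringNumber_unionSquares_self (hδ : 0 < δ) (P : Finset (ℤ × ℤ)) :
    coveringNumber δ (unionSquares δ P) = P.card := by
  have := coveringNumber_unionSquares hδ one_pos P
  simpa [anc_one, show anc 1 = id from funext anc_one] using this

open Classical in
/-- The squares among `D` that are contained in the `6w`-neighbourhood of a tube. -/
noncomputable def incident (w : ℝ) (W : ℤ × ℤ) (D : Finset (ℤ × ℤ)) : Finset (ℤ × ℤ) :=
  {Q ∈ D | dyadicSquare w Q ⊆ Metric.cthickening (6 * w) (dyadicTube w W)}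

theorem mem_incident {w : ℝ} {W Q : ℤ × ℤ} {D : Finset (ℤ × ℤ)} : Q ∈ incident w W D ↔
    Q ∈ D ∧ dyadicSquare w Q ⊆ Metric.cthickening (6 * w) (dyadicTube w W) := by
  classical
  rw [incident, Finset.mem_filter]

theorem incidenceCount_unionSquares (hδ : 0 < δ) (hN : 0 < N) (W : ℤ × ℤ) (P : Finset (ℤ × ℤ)) :
    incidenceCount (N * δ) W (unionSquares δ P) =
      (incident (N * δ) W (P.image (anc N))).card := by
  rw [incidenceCount, dyadicCover_unionSquares hδ hN, ← Set.ncard_coe_finset]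
  congr 1
  ext Q
  simp [mem_incident]

theorem mem_Ico_of_mem_dyadicCover_unitSquare (hδ : 0 < δ) {M : ℕ} (hM : (M : ℝ) * (N * δ) = 1)
    {p : ℤ × ℤ} (hp : p ∈ dyadicCover δ unitSquare) (hN : 0 < N) :
    (anc N p).1 ∈ Finset.Ico (0 : ℤ) M ∧ (anc N p).2 ∈ Finset.Ico (0 : ℤ) M := by
  obtain ⟨x, hx, ⟨u1, u2, u3, u4⟩⟩ := hp
  obtain ⟨h1, h2, h3, h4⟩ := dyadicSquare_subset_anc hδ hN p hx
  have hw : 0 < N * δ := by positivity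
  have key : ∀ (i : ℤ) (y : ℝ), 0 ≤ y → y < 1 → i * (N * δ) ≤ y → y < (i + 1) * (N * δ) →
      i ∈ Finset.Ico (0 : ℤ) M := by
    intro i y y0 y1 hi hi'
    have e1 : (0 : ℝ) < i + 1 := pos_of_mul_pos_left (y0.trans_lt hi') hw.le
    have e2 : (i : ℝ) < M := by
      by_contra hcon
      have := mul_le_mul_of_nonneg_right (not_lt.1 hcon) hw.le
      linarith
    rw [Finset.mem_Ico]
    constructor
    · have : (0 : ℤ) < i + 1 := by exact_mod_cast e1
      omega
    · exact_mod_cast e2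
  exact ⟨key _ _ u1 u2 h1 h2, key _ _ u3 u4 h3 h4⟩

theorem slope_bounds {w : ℝ} (hw1 : w ≤ 1) {W : ℤ × ℤ}
    (hW : W ∈ dyadicCover w slopeStrip) : -2 ≤ W.1 * w ∧ (W.1 + 1) * w ≤ 2 := by
  obtain ⟨x, ⟨h1, h2, -, -⟩, ⟨u1, u2⟩⟩ := hW
  constructor <;> linarith

theorem anc_mem_dyadicCover (hδ : 0 < δ) (hN : 0 < N) {S : Set Plane} {q : ℤ × ℤ}
    (hq : q ∈ dyadicCover δ S) : anc N q ∈ dyadicCover (N * δ) S := by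
  obtain ⟨x, hx, hxS⟩ := hq
  exact ⟨x, dyadicSquare_subset_anc hδ hN q hx, hxS⟩

/-- A dyadic tube is contained in a unique dyadic tube of a given larger width. -/
theorem eq_anc_of_dyadicTube_subset (hδ : 0 < δ) (hN : 0 < N) {q W : ℤ × ℤ}
    (h : dyadicTube δ q ⊆ dyadicTube (N * δ) W) : W = anc N q := by
  set w : ℝ := N * δ with hwdef
  have hw : 0 < w := by positivity
  have hN' : (0 : ℤ) < N := by exact_mod_cast hN
  -- The midpoint slope keeps `a` off the dyadic endpoints, so the non-strict bounds below still
  -- determine the ancestor. The intercept is read off at `X = 0`.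
  set a : ℝ := (q.1 + 1 / 2) * δ with ha
  set b : ℝ := q.2 * δ with hb
  have hline : ∀ X : ℝ, ∃ v ∈ dyadicSquare w W, a * X + b = v 0 * X + v 1 := by
    intro X
    have hv : (!₂[a, b] : Plane) ∈ dyadicSquare δ q := by
      refine ⟨?_, ?_, ?_, ?_⟩ <;> simp [ha, hb] <;> nlinarith
    have hz : (!₂[X, a * X + b] : Plane) ∈ dyadicTube δ q :=
      mem_dyadicTube.2 ⟨_, hv, by simp⟩
    obtain ⟨v, hv, e⟩ := mem_dyadicTube.1 (h hz)
    exact ⟨v, hv, by simpa using e⟩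
  obtain ⟨v, ⟨-, -, hb1, hb2⟩, ev⟩ := hline 0
  rw [mul_zero, mul_zero, zero_add, zero_add] at ev
  rw [← ev] at hb1 hb2
  obtain ⟨c1, c2⟩ := ediv_mul_le_mul hδ hN q.2
  have hlow : W.1 * w ≤ a := by
    by_contra hcon
    rw [not_le] at hcon
    have hd : 0 < W.1 * w - a := by linarith
    obtain ⟨v, ⟨v1, v2, v3, v4⟩, ev⟩ := hline (w / (W.1 * w - a))
    -- At this abscissa the slope gap alone has moved the line by `w`, the full height of the range
    -- of intercepts.
    have hX : 0 < w / (W.1 * w - a) := by positivity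
    have e : (W.1 * w - a) * (w / (W.1 * w - a)) = w := by field_simp
    nlinarith
  have hupp : a ≤ (W.1 + 1) * w := by
    by_contra hcon
    rw [not_le] at hcon
    have hd : 0 < a - (W.1 + 1) * w := by linarith
    obtain ⟨v, ⟨v1, v2, v3, v4⟩, ev⟩ := hline (w / (a - (W.1 + 1) * w))
    have hX : 0 < w / (a - (W.1 + 1) * w) := by positivity
    have e : (a - (W.1 + 1) * w) * (w / (a - (W.1 + 1) * w)) = w := by field_simp
    nlinarith
  refine Prod.ext ?_ ?_
  · have e1 : (W.1 : ℝ) * N ≤ q.1 + 1 / 2 := by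
      rw [hwdef, ha, ← mul_assoc] at hlow
      exact le_of_mul_le_mul_right hlow hδ
    have e2 : (q.1 : ℝ) + 1 / 2 ≤ (W.1 + 1) * N := by
      rw [hwdef, ha, ← mul_assoc] at hupp
      exact le_of_mul_le_mul_right hupp hδ
    have e3 : W.1 * N < q.1 + 1 := by
      have : ((W.1 * N : ℤ) : ℝ) < ((q.1 + 1 : ℤ) : ℝ) := by push_cast; linarith
      exact_mod_cast this
    have e4 : q.1 < (W.1 + 1) * N := by
      have : ((q.1 : ℤ) : ℝ) < (((W.1 + 1) * N : ℤ) : ℝ) := by push_cast; linarith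
      exact_mod_cast this
    refine le_antisymm ((Int.le_ediv_iff_mul_le hN').2 (by omega)) ?_
    exact Int.lt_add_one_iff.1 ((Int.ediv_lt_iff_lt_mul hN').2 e4)
  · rw [eq_floor_of_mem_cell hw hb1 hb2]
    exact (eq_floor_of_mem_cell hw c1 (by nlinarith)).symm

/-! ### Geometry of incidences and counting in `(δ, s, C)`-sets -/

theorem abs_sub_apply_le_dist (x y : Plane) (i : Fin 2) : |x i - y i| ≤ dist x y := by
  rw [dist_eq_norm]
  exact PiLp.norm_apply_le (x - y) i

theorem dist_le_abs_add_abs (x y : Plane) : dist x y ≤ |x 0 - y 0| + |x 1 - y 1| := by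
  rw [EuclideanSpace.dist_eq, Fin.sum_univ_two, Real.dist_eq, Real.dist_eq]
  refine Real.sqrt_le_iff.2 ⟨by positivity, ?_⟩
  nlinarith [abs_nonneg (x 0 - y 0), abs_nonneg (x 1 - y 1)]

theorem dist_lt_of_mem_dyadicSquare {Q : ℤ × ℤ} {x y : Plane} (hx : x ∈ dyadicSquare δ Q)
    (hy : y ∈ dyadicSquare δ Q) : dist x y < 2 * δ := by
  obtain ⟨h1, h2, h3, h4⟩ := hx
  obtain ⟨k1, k2, k3, k4⟩ := hy
  have e0 : |x 0 - y 0| < δ := abs_lt.2 ⟨by linarith, by linarith⟩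
  have e1 : |x 1 - y 1| < δ := abs_lt.2 ⟨by linarith, by linarith⟩
  linarith [dist_le_abs_add_abs x y]

/-- A square that contains a point close to a line of a tube is incident to the tube. -/
theorem dyadicSquare_subset_cthickening {w : ℝ} {W Q : ℤ × ℤ} {v z : Plane}
    (hv : v ∈ dyadicSquare w W) (hz : z ∈ dyadicSquare w Q) (h : |z 1 - v 0 * z 0 - v 1| ≤ w) :
    dyadicSquare w Q ⊆ Metric.cthickening (6 * w) (dyadicTube w W) := by
  intro x hx
  refine Metric.mem_cthickening_of_dist_le x (!₂[z 0, v 0 * z 0 + v 1]) _ _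
    (mem_dyadicTube.2 ⟨v, hv, by simp⟩) ?_
  have h1 := dist_lt_of_mem_dyadicSquare hx hz
  have h2 := dist_le_abs_add_abs z !₂[z 0, v 0 * z 0 + v 1]
  simp only [Matrix.cons_val_zero, Matrix.cons_val_one, sub_self, abs_zero,
    zero_add, ← sub_sub] at h2
  have h3 := dist_triangle x z !₂[z 0, v 0 * z 0 + v 1]
  have := abs_nonneg (z 1 - v 0 * z 0 - v 1)
  linarith

/-- A square incident to a tube is close to every line of the tube. -/
theorem abs_sub_le_of_subset_cthickening {w : ℝ} (hw : 0 < w) {W Q : ℤ × ℤ}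
    (hslope : -2 ≤ W.1 * w ∧ (W.1 + 1) * w ≤ 2) (hQ0 : 0 ≤ Q.1 * w) (hQ1 : Q.1 * w ≤ 1)
    (h : dyadicSquare w Q ⊆ Metric.cthickening (6 * w) (dyadicTube w W)) {a b : ℝ}
    (ha : W.1 * w ≤ a) (ha' : a < (W.1 + 1) * w) (hb : W.2 * w ≤ b) (hb' : b < (W.2 + 1) * w) :
    |Q.2 * w - a * (Q.1 * w) - b| ≤ 24 * w := by
  -- Enlarging `6 w` to `7 w` gives an actual nearby point. The total error is `7 w` from the
  -- height, `14 w` from the abscissa with slope at most `2`, and `w` each from moving slope and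
  -- intercept inside the cell: `23 w` in all.
  have hc := Metric.cthickening_subset_thickening' (δ₂ := 7 * w) (by linarith) (by linarith) _
    (h (corner_mem_dyadicSquare hw Q))
  obtain ⟨z, hz, hd⟩ := Metric.mem_thickening_iff.1 hc
  obtain ⟨v, ⟨v1, v2, v3, v4⟩, e⟩ := mem_dyadicTube.1 hz
  have d0 := abs_sub_apply_le_dist (!₂[(Q.1 : ℝ) * w, (Q.2 : ℝ) * w]) z 0
  have d1 := abs_sub_apply_le_dist (!₂[(Q.1 : ℝ) * w, (Q.2 : ℝ) * w]) z 1
  simp only [Matrix.cons_val_zero, Matrix.cons_val_one] at d0 d1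
  set x : ℝ := Q.1 * w
  set y : ℝ := Q.2 * w
  have t1 : |y - z 1| ≤ 7 * w := d1.trans hd.le
  have t2 : |v 0 * (z 0 - x)| ≤ 2 * (7 * w) := by
    rw [abs_mul, abs_sub_comm]
    refine mul_le_mul (abs_le.2 ⟨by linarith, by linarith⟩) (d0.trans hd.le) (abs_nonneg _)
      (by norm_num)
  have t3 : |(v 0 - a) * x| ≤ w * 1 := by
    rw [abs_mul, abs_of_nonneg hQ0]
    exact mul_le_mul (abs_le.2 ⟨by linarith, by linarith⟩) hQ1 hQ0 hw.le
  have t4 : |v 1 - b| ≤ w := abs_le.2 ⟨by linarith, by linarith⟩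
  rw [abs_le] at *
  constructor <;> nlinarith

theorem card_le_of_isDeltaSet {s C : ℝ} {P P' : Finset (ℤ × ℤ)} (hδ : 0 < δ)
    (h : IsDeltaSet δ s C (unionSquares δ P)) (hP' : P' ⊆ P) {x : Plane} {r : ℝ} (hr : δ ≤ r)
    (hr1 : r ≤ 1) (hx : ∀ p ∈ P', ∃ z ∈ dyadicSquare δ p, z ∈ Metric.ball x r) :
    (P'.card : ℝ) ≤ C * r ^ s * P.card := by
  have h1 := h.card_le x r hr hr1
  rw [coveringNumber_unionSquares_self hδ] at h1
  refine le_trans ?_ h1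
  rw [coveringNumber, Nat.cast_le, ← Set.ncard_coe_finset P']
  refine Set.ncard_le_ncard ?_ ?_
  · intro p hp
    obtain ⟨z, hz, hzx⟩ := hx p hp
    exact ⟨z, hz, mem_unionSquares.2 ⟨p, hP' hp, hz⟩, hzx⟩
  · refine (Finset.finite_toSet P).subset ?_
    rintro p ⟨z, hz, hzP, -⟩
    obtain ⟨p', hp', hz'⟩ := mem_unionSquares.1 hzP
    rw [eq_of_mem_dyadicSquare hδ hz hz']
    exact hp'

/-- A square of side `w` lies in the ball of radius `2 w` about its corner, and `2 ^ s ≤ 4`. -/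
theorem card_anc_eq_le_of_isDeltaSet {s C : ℝ} {P : Finset (ℤ × ℤ)} (hδ : 0 < δ) (hC : 0 ≤ C)
    (h : IsDeltaSet δ s C (unionSquares δ P)) (hs : s ≤ 2) (hN : 0 < N) (hN1 : 2 * (N * δ) ≤ 1)
    (Q : ℤ × ℤ) :
    (({p ∈ P | anc N p = Q}).card : ℝ) ≤ 4 * C * (N * δ) ^ s * P.card := by
  have hw : 0 < N * δ := by positivity
  have hNr : (1 : ℝ) ≤ N := by exact_mod_cast hN
  refine (card_le_of_isDeltaSet hδ h (Finset.filter_subset _ _)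
    (x := !₂[(Q.1 : ℝ) * (N * δ), (Q.2 : ℝ) * (N * δ)]) (r := 2 * (N * δ)) (by nlinarith) hN1
    ?_).trans ?_
  · intro p hp
    have hpQ := (Finset.mem_filter.1 hp).2
    refine ⟨_, corner_mem_dyadicSquare hδ p, ?_⟩
    refine dist_lt_of_mem_dyadicSquare (Q := Q) ?_ (corner_mem_dyadicSquare hw Q)
    rw [← hpQ]
    exact dyadicSquare_subset_anc hδ hN p (corner_mem_dyadicSquare hδ p)
  · rw [Real.mul_rpow zero_le_two hw.le]
    have h2 : (2 : ℝ) ^ s ≤ 4 := by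
      calc (2 : ℝ) ^ s ≤ (2 : ℝ) ^ (2 : ℝ) := Real.rpow_le_rpow_of_exponent_le one_le_two hs
        _ = 4 := by norm_num
    have h3 : 0 ≤ (N * δ) ^ s := Real.rpow_nonneg hw.le s
    have h4 : 0 ≤ C * (N * δ) ^ s * P.card := by positivity
    calc C * (2 ^ s * (N * δ) ^ s) * P.card = 2 ^ s * (C * (N * δ) ^ s * P.card) := by ring
      _ ≤ 4 * (C * (N * δ) ^ s * P.card) := by gcongr
      _ = _ := by ring

theorem nonempty_of_isDeltaSet {s C : ℝ} {P : Finset (ℤ × ℤ)}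
    (h : IsDeltaSet δ s C (unionSquares δ P)) : P.Nonempty := by
  obtain ⟨x, hx⟩ := h.nonempty
  obtain ⟨p, hp, -⟩ := mem_unionSquares.1 hx
  exact ⟨p, hp⟩

/-- The unit ball about the centre contains the whole unit square. This is needed to have `lam ≥ 1`,
the start of the induction over scales. -/
theorem one_le_of_isDeltaSet {s C : ℝ} {P : Finset (ℤ × ℤ)} (hδ : 0 < δ) (hδ1 : δ ≤ 1)
    (h : IsDeltaSet δ s C (unionSquares δ P)) (hP : ∀ p ∈ P, p ∈ dyadicCover δ unitSquare) :
    1 ≤ C := by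
  have hc := card_le_of_isDeltaSet hδ h subset_rfl (x := !₂[(1 / 2 : ℝ), (1 / 2 : ℝ)]) (r := 1)
    hδ1 le_rfl ?_
  · rw [Real.one_rpow, mul_one] at hc
    have : (0 : ℝ) < P.card := by exact_mod_cast (nonempty_of_isDeltaSet h).card_pos
    by_contra hcon
    nlinarith
  · intro p hp
    obtain ⟨z, hz, z1, z2, z3, z4⟩ := hP p hp
    refine ⟨z, hz, ?_⟩
    rw [Metric.mem_ball, EuclideanSpace.dist_eq, Fin.sum_univ_two, Real.dist_eq, Real.dist_eq,
      Real.sqrt_lt' one_pos, sq_abs, sq_abs]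
    simp only [Matrix.cons_val_zero, Matrix.cons_val_one]
    nlinarith

end

/-! ### Uniformisation by pigeonholing fibre sizes -/

section Pigeonhole
variable {α : Type*} [DecidableEq α]

/-- A finite set has a large subset all of whose points lie in fibres of comparable size, for
finitely many maps at once. -/
theorem exists_uniform_subset (P₀ : Finset α) (f : ℕ → α → α) (n J : ℕ)
    (hJ : Nat.log 2 P₀.card ≤ J) :
    ∃ P ⊆ P₀, ∃ j : ℕ → ℕ, P₀.card ≤ (J + 1) ^ (n + 1) * P.card ∧
      ∀ k ≤ n, ∀ p ∈ P, 2 ^ j k ≤ (P₀.filter fun p' => f k p' = f k p).card ∧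
        (P₀.filter fun p' => f k p' = f k p).card < 2 ^ (j k + 1) := by
  classical
  -- All scales are pigeonholed at once by the vector of dyadic size classes. Fibres are measured in
  -- `P₀` and not in the subset, so selecting one class does not change them.
  set g : α → (Fin (n + 1) → Fin (J + 1)) := fun p k =>
    ⟨Nat.log 2 (P₀.filter fun p' => f k p' = f k p).card, Nat.lt_succ_of_le
      ((Nat.log_mono_right (Finset.card_filter_le _ _)).trans hJ)⟩ with hg
  obtain ⟨v, -, hv⟩ := Finset.exists_max_image (Finset.univ : Finset (Fin (n + 1) → Fin (J + 1)))
    (fun v => (P₀.filter fun p => g p = v).card) ⟨fun _ => 0, Finset.mem_univ _⟩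
  refine ⟨P₀.filter fun p => g p = v, Finset.filter_subset _ _,
    fun k => if h : k < n + 1 then v ⟨k, h⟩ else 0, ?_, ?_⟩
  · have := Finset.card_le_mul_card_image_of_maps_to (s := P₀) (f := g) (t := Finset.univ)
      (fun _ _ => Finset.mem_univ _) _ hv
    rw [Finset.card_univ, Fintype.card_fun, Fintype.card_fin, Fintype.card_fin] at this
    rwa [mul_comm]
  · intro k hk p hp
    obtain ⟨hp0, hpv⟩ := Finset.mem_filter.1 hp
    have hk' : k < n + 1 := Nat.lt_succ_of_le hk
    have e : (v ⟨k, hk'⟩ : ℕ) = Nat.log 2 (P₀.filter fun p' => f k p' = f k p).card := by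
      rw [← hpv]
    simp only [hk', dif_pos, e]
    refine ⟨Nat.pow_log_le_self 2 ?_, Nat.lt_pow_succ_log_self one_lt_two _⟩
    exact (Finset.card_pos.2 ⟨p, by simpa using hp0⟩).ne'

variable {P₀ P : Finset α} {f : α → α} {j H : ℕ}

theorem card_fiber_le_of_uniform (hsub : P ⊆ P₀)
    (hup : ∀ p ∈ P, (P₀.filter fun p' => f p' = f p).card < 2 ^ (j + 1)) (Q : α) :
    (P.filter fun p => f p = Q).card ≤ 2 ^ (j + 1) := by
  rcases (P.filter fun p => f p = Q).eq_empty_or_nonempty with h | ⟨p, hp⟩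
  · simp [h]
  · obtain ⟨hpP, rfl⟩ := Finset.mem_filter.1 hp
    exact (Finset.card_le_card (Finset.filter_subset_filter _ hsub)).trans (hup p hpP).le

theorem card_le_of_uniform (hsub : P ⊆ P₀)
    (hup : ∀ p ∈ P, (P₀.filter fun p' => f p' = f p).card < 2 ^ (j + 1)) :
    P.card ≤ 2 ^ (j + 1) * (P.image f).card :=
  Finset.card_le_mul_card_image_of_maps_to (fun _ hp => Finset.mem_image_of_mem f hp) _
    fun Q _ => card_fiber_le_of_uniform hsub hup Q

/-- Fibres over distinct points are disjoint, and each has at least `2 ^ j` elements in `P₀`. -/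
theorem card_image_mul_le_of_uniform
    (hlow : ∀ p ∈ P, 2 ^ j ≤ (P₀.filter fun p' => f p' = f p).card) (S : Finset α)
    (hS : S ⊆ P.image f) :
    S.card * 2 ^ j ≤ (P₀.filter fun p => f p ∈ S).card := by
  rw [Finset.card_eq_sum_card_fiberwise (s := P₀.filter fun p => f p ∈ S) (f := f) (t := S)
    (fun p hp => (Finset.mem_filter.1 hp).2), ← smul_eq_mul]
  refine Finset.card_nsmul_le_sum _ _ _ fun Q hQ => ?_
  obtain ⟨p, hp, rfl⟩ := Finset.mem_image.1 (hS hQ)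
  refine (hlow p hp).trans (Finset.card_le_card fun p' hp' => ?_)
  obtain ⟨h1, h2⟩ := Finset.mem_filter.1 hp'
  exact Finset.mem_filter.2 ⟨Finset.mem_filter.2 ⟨h1, by rwa [h2]⟩, h2⟩

theorem card_image_mul_le_of_uniform' (hH : P₀.card ≤ H * P.card)
    (hlow : ∀ p ∈ P, 2 ^ j ≤ (P₀.filter fun p' => f p' = f p).card) :
    (P.image f).card * 2 ^ j ≤ H * P.card :=
  ((card_image_mul_le_of_uniform hlow _ subset_rfl).trans (Finset.card_filter_le _ _)).trans hH

theorem card_fiber_mul_le_of_uniform (hsub : P ⊆ P₀) (hH : P₀.card ≤ H * P.card)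
    (hlow : ∀ p ∈ P, 2 ^ j ≤ (P₀.filter fun p' => f p' = f p).card)
    (hup : ∀ p ∈ P, (P₀.filter fun p' => f p' = f p).card < 2 ^ (j + 1)) (Q : α) :
    (P.filter fun p => f p = Q).card * (P.image f).card ≤ 2 * H * P.card := by
  calc _ ≤ 2 ^ (j + 1) * (P.image f).card :=
        Nat.mul_le_mul_right _ (card_fiber_le_of_uniform hsub hup Q)
    _ = 2 * ((P.image f).card * 2 ^ j) := by ring
    _ ≤ 2 * (H * P.card) := Nat.mul_le_mul_left _ (card_image_mul_le_of_uniform' hH hlow)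
    _ = _ := by ring

/-- A parent has at most `2 ^ (j' + 1) / 2 ^ j` children, by counting in its fibre in `P₀`. There
are at most `H |P| / 2 ^ j'` parents, and `|P|` is at most `2 ^ (j + 1)` times the number of fine
squares. The powers cancel, leaving `4 H`. -/
theorem card_children_mul_le_of_uniform {f' g : α → α} {j' : ℕ} (hg : ∀ p, g (f p) = f' p)
    (hsub : P ⊆ P₀) (hH : P₀.card ≤ H * P.card)
    (hlow : ∀ p ∈ P, 2 ^ j ≤ (P₀.filter fun p' => f p' = f p).card)
    (hup : ∀ p ∈ P, (P₀.filter fun p' => f p' = f p).card < 2 ^ (j + 1))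
    (hlow' : ∀ p ∈ P, 2 ^ j' ≤ (P₀.filter fun p' => f' p' = f' p).card)
    (hup' : ∀ p ∈ P, (P₀.filter fun p' => f' p' = f' p).card < 2 ^ (j' + 1)) (Q : α) :
    ((P.image f).filter fun R => g R = Q).card * (P.image f').card ≤
      4 * H * (P.image f).card := by
  rcases ((P.image f).filter fun R => g R = Q).eq_empty_or_nonempty with h | ⟨R, hR⟩
  · simp [h]
  have h1 : ((P.image f).filter fun R => g R = Q).card * 2 ^ j ≤ 2 ^ (j' + 1) := by
    refine (card_image_mul_le_of_uniform hlow _ (Finset.filter_subset _ _)).trans ?_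
    obtain ⟨hR1, hR2⟩ := Finset.mem_filter.1 hR
    obtain ⟨p, hp, rfl⟩ := Finset.mem_image.1 hR1
    refine le_trans (Finset.card_le_card fun p' hp' => ?_) (hup' p hp).le
    obtain ⟨h3, h4⟩ := Finset.mem_filter.1 hp'
    refine Finset.mem_filter.2 ⟨h3, ?_⟩
    rw [← hg, ← hg, hR2, (Finset.mem_filter.1 h4).2]
  have h2 := card_image_mul_le_of_uniform' hH hlow'
  have h3 := card_le_of_uniform hsub hup
  have hpos : 0 < 2 ^ j := by positivity
  refine Nat.le_of_mul_le_mul_right ?_ hpos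
  calc _ = (((P.image f).filter fun R => g R = Q).card * 2 ^ j) * (P.image f').card := by ring
    _ ≤ 2 ^ (j' + 1) * (P.image f').card := Nat.mul_le_mul_right _ h1
    _ = 2 * ((P.image f').card * 2 ^ j') := by ring
    _ ≤ 2 * (H * P.card) := Nat.mul_le_mul_left _ h2
    _ ≤ 2 * (H * (2 ^ (j + 1) * (P.image f).card)) := by gcongr
    _ = _ := by ring

end Pigeonhole

/-! ### Incidences of tubes that are richer than their parents -/

theorem card_filter_mem_le_sum {α : Type*} [DecidableEq α] (f : α → α) (D S : Finset α) :
    ((D.filter fun x => f x ∈ S).card : ℝ) ≤ ∑ y ∈ S, ((D.filter fun x => f x = y).card : ℝ) := by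
  rw [Finset.card_eq_sum_card_fiberwise (s := D.filter fun x => f x ∈ S) (f := f) (t := S)
    (fun x hx => (Finset.mem_filter.1 hx).2), Nat.cast_sum]
  refine Finset.sum_le_sum fun y _ => ?_
  exact_mod_cast Finset.card_le_card (Finset.filter_subset_filter _ (Finset.filter_subset _ _))

theorem card_filter_mem_le_mul {α : Type*} [DecidableEq α] {f : α → α} {D : Finset α} {κ : ℝ}
    (hκ : ∀ y, ((D.filter fun x => f x = y).card : ℝ) ≤ κ) (S : Finset α) :
    ((D.filter fun x => f x ∈ S).card : ℝ) ≤ S.card * κ := by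
  refine (card_filter_mem_le_sum f D S).trans ?_
  rw [← nsmul_eq_mul]
  exact Finset.sum_le_card_nsmul _ _ κ fun y _ => hκ y

section
variable {δ : ℝ} {N : ℕ}

/-- The mean square of the incidence counts of the tubes that are richer than their parents. -/
theorem sum_incident_sq_le {w : ℝ} (hw : 0 < w) (hN : 24 ≤ N) {R : ℕ} (hR : (R : ℝ) * w = 1)
    {D 𝒲 : Finset (ℤ × ℤ)} {κ : ℝ}
    (hD : ∀ Q ∈ D, Q.1 ∈ Finset.Ico (0 : ℤ) R ∧ Q.2 ∈ Finset.Ico (0 : ℤ) R)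
    (hκ : ∀ Q', ((D.filter fun Q => anc N Q = Q').card : ℝ) ≤ κ)
    (hslope : ∀ W ∈ 𝒲, -2 ≤ W.1 * w ∧ (W.1 + 1) * w ≤ 2)
    (hbad : ∀ W ∈ 𝒲, 48 * κ * ((incident (N * w) (anc N W) (D.image (anc N))).card : ℝ) ≤
      N * ((incident w W D).card : ℝ)) :
    ∑ W ∈ 𝒲, ((incident w W D).card : ℝ) ^ 2 ≤
      D.card * (9216 * corrConst * (N / w) * (2 * (2 + Real.log R)) ^ 2) := by
  have hN0 : 0 < N := by omega
  have hNr : (24 : ℝ) ≤ N := by exact_mod_cast hN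
  have hR1 : 1 ≤ R := by
    rcases Nat.eq_zero_or_pos R with rfl | h
    · simp at hR
    · exact h
  -- The width `24 w` catches every incident square, and `24 ≤ N` orders the two widths. The fine
  -- average is at least `count / (48 w)` and the coarse one at most half of that, which leaves
  -- `count / (96 w)`; hence `9216 = 96 ^ 2`.
  have h := sum_sq_le_of_countDiff (ρ₁ := 24 * w) (ρ₂ := N * w) (w := w) (by positivity)
    (by gcongr) hw (by linarith) R hR1 D 𝒲 hD (fun W => ((incident w W D).card : ℝ) / (96 * w))
    (fun W _ => by positivity) hslope ?_
  · have e1 : ∑ W ∈ 𝒲, w ^ 2 * (((incident w W D).card : ℝ) / (96 * w)) ^ 2 =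
        (1 / 9216) * ∑ W ∈ 𝒲, ((incident w W D).card : ℝ) ^ 2 := by
      rw [Finset.mul_sum]
      refine Finset.sum_congr rfl fun W _ => ?_
      field_simp
      norm_num
    have e2 : (N * w / w ^ 2 : ℝ) = N / w := by field_simp
    rw [e1, e2] at h
    linarith
  · intro W hW a b ha ha' hb hb'
    simp only [countDiff, boxDiff]
    rw [Finset.sum_sub_distrib]
    have hlow : ((incident w W D).card : ℝ) * (1 / (2 * (24 * w))) ≤
        ∑ Q ∈ D, box (24 * w) (Q.2 * w - a * (Q.1 * w) - b) := by
      rw [← nsmul_eq_mul, ← Finset.sum_const]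
      refine le_trans (Finset.sum_le_sum fun Q hQ => ?_)
        (Finset.sum_le_sum_of_subset_of_nonneg (s := incident w W D)
          (fun Q hQ => (mem_incident.1 hQ).1) fun Q _ _ => box_nonneg (by positivity) _)
      obtain ⟨hQD, hQ⟩ := mem_incident.1 hQ
      have hQ1 := Finset.mem_Ico.1 (hD Q hQD).1
      have c0 : (0 : ℝ) ≤ Q.1 := by exact_mod_cast hQ1.1
      have c1 : (Q.1 : ℝ) ≤ R := by exact_mod_cast hQ1.2.le
      rw [box_of_le (abs_sub_le_of_subset_cthickening hw (hslope W hW) (by positivity)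
        (by rw [← hR]; gcongr) hQ ha ha' hb hb')]
    have hupp : ∑ Q ∈ D, box (N * w) (Q.2 * w - a * (Q.1 * w) - b) ≤
        (κ * ((incident (N * w) (anc N W) (D.image (anc N))).card : ℝ)) * (1 / (2 * (N * w))) := by
      have hv : (!₂[a, b] : Plane) ∈ dyadicSquare (N * w) (anc N W) :=
        dyadicSquare_subset_anc hw hN0 W (by
          refine ⟨?_, ?_, ?_, ?_⟩ <;> simpa)
      have hzero : ∀ Q ∈ D, Q ∉ (D.filter fun Q =>
          anc N Q ∈ incident (N * w) (anc N W) (D.image (anc N))) →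
          box (N * w) (Q.2 * w - a * (Q.1 * w) - b) = 0 := by
        intro Q hQ hnot
        refine box_of_lt (not_le.1 fun hle => hnot ?_)
        refine Finset.mem_filter.2 ⟨hQ, mem_incident.2 ⟨Finset.mem_image_of_mem _ hQ, ?_⟩⟩
        exact dyadicSquare_subset_cthickening hv
          (dyadicSquare_subset_anc hw hN0 Q (corner_mem_dyadicSquare hw Q)) (by simpa using hle)
      rw [← Finset.sum_subset (Finset.filter_subset _ D) hzero]
      refine (Finset.sum_le_card_nsmul _ _ (1 / (2 * (N * w)))
        fun Q _ => box_le (by positivity) _).trans ?_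
      rw [nsmul_eq_mul]
      refine mul_le_mul_of_nonneg_right ?_ (by positivity)
      exact (card_filter_mem_le_mul hκ _).trans_eq (mul_comm _ _)
    have hb := hbad W hW
    have e1 : ((incident w W D).card : ℝ) / (96 * w) =
        ((incident w W D).card : ℝ) * (1 / (2 * (24 * w))) -
        (N * ((incident w W D).card : ℝ)) * (1 / (96 * (N * w))) := by
      field_simp
      ring
    have e2 : (κ * ((incident (N * w) (anc N W) (D.image (anc N))).card : ℝ)) *
        (1 / (2 * (N * w))) =
        (48 * κ * ((incident (N * w) (anc N W) (D.image (anc N))).card : ℝ)) *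
        (1 / (96 * (N * w))) := by
      field_simp
      ring
    have h3 := mul_le_mul_of_nonneg_right hb (show 0 ≤ 1 / (96 * (N * w)) by positivity)
    linarith

/-- The number of incidences of squares in `P` with tubes whose ancestors lie in `𝒲`. -/
theorem sum_card_filter_anc_le (hδ : 0 < δ) (hN : 0 < N) {P : Finset (ℤ × ℤ)}
    {Tp : ℤ × ℤ → Finset (ℤ × ℤ)}
    (hmeet : ∀ p ∈ P, ∀ q ∈ Tp p, (dyadicTube δ q ∩ dyadicSquare δ p).Nonempty)
    {𝒲 : Finset (ℤ × ℤ)} {β τ : ℝ} (hτ : 0 ≤ τ)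
    (hβ : ∀ Q, ((P.filter fun p => anc N p = Q).card : ℝ) ≤ β)
    (hTp : ∀ p ∈ P, ∀ W, (((Tp p).filter fun q => anc N q = W).card : ℝ) ≤ τ) :
    ∑ p ∈ P, (((Tp p).filter fun q => anc N q ∈ 𝒲).card : ℝ) ≤
      ∑ W ∈ 𝒲, ((incident (N * δ) W (P.image (anc N))).card : ℝ) * β * τ := by
  have hw : 0 < N * δ := by positivity
  refine (Finset.sum_le_sum fun p _ => card_filter_mem_le_sum (anc N) (Tp p) 𝒲).trans ?_
  rw [Finset.sum_comm]
  refine Finset.sum_le_sum fun W _ => ?_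
  -- If `q ∈ Tp p`, a line of `q` passes through `p`, so the ancestors of `p` and `q` are incident.
  have hzero : ∀ p ∈ P, p ∉ (P.filter fun p =>
      anc N p ∈ incident (N * δ) W (P.image (anc N))) →
      (((Tp p).filter fun q => anc N q = W).card : ℝ) = 0 := by
    intro p hp hnot
    rw [Nat.cast_eq_zero, Finset.card_eq_zero, Finset.filter_eq_empty_iff]
    rintro q hq rfl
    refine hnot (Finset.mem_filter.2 ⟨hp, mem_incident.2 ⟨Finset.mem_image_of_mem _ hp, ?_⟩⟩)
    obtain ⟨z, hzt, hzp⟩ := hmeet p hp q hq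
    obtain ⟨v, hv, e⟩ := mem_dyadicTube.1 hzt
    refine dyadicSquare_subset_cthickening (dyadicSquare_subset_anc hδ hN q hv)
      (dyadicSquare_subset_anc hδ hN p hzp) ?_
    rw [e, show v 0 * z 0 + v 1 - v 0 * z 0 - v 1 = 0 by ring, abs_zero]
    exact hw.le
  rw [← Finset.sum_subset (Finset.filter_subset _ P) hzero]
  refine (Finset.sum_le_card_nsmul _ _ τ
    fun p hp => hTp p (Finset.mem_filter.1 hp).1 W).trans ?_
  rw [nsmul_eq_mul]
  refine mul_le_mul_of_nonneg_right ?_ hτ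
  exact card_filter_mem_le_mul hβ _

end

/-- The number of squares of `D` incident to a tube, relative to its expected size. -/
noncomputable def richness (w : ℝ) (W : ℤ × ℤ) (D : Finset (ℤ × ℤ)) : ℝ :=
  (incident w W D).card / (w * D.card)

theorem card_incident_eq {w : ℝ} (hw : 0 < w) (W : ℤ × ℤ) {D : Finset (ℤ × ℤ)}
    (hD : D.Nonempty) : ((incident w W D).card : ℝ) = richness w W D * (w * D.card) := by
  have : (0 : ℝ) < D.card := by exact_mod_cast hD.card_pos
  unfold richness
  field_simp

theorem richness_one_le (W : ℤ × ℤ) (D : Finset (ℤ × ℤ)) : richness 1 W D ≤ 1 := by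
  unfold richness
  rw [one_mul]
  refine div_le_one_of_le₀ ?_ (Nat.cast_nonneg _)
  exact_mod_cast Finset.card_le_card fun Q hQ => (mem_incident.1 hQ).1

/-- The constant in `sum_card_bad_le`. -/
noncomputable def badConst : ℝ := 9216 * 64 * 36 * corrConst

theorem one_le_badConst : 1 ≤ badConst := by
  have := integral_slopeCutoff_nonneg
  unfold badConst corrConst
  nlinarith

/-- The number of incidences with tubes that are rich and richer than their parents. -/
theorem sum_card_bad_le {δ : ℝ} (hδ : 0 < δ) {N A R : ℕ} (hN : 24 ≤ N) (hA : 0 < A) {w : ℝ}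
    (hw : w = A * δ) (hR : (R : ℝ) * w = 1) (hw1 : w ≤ 1) {ℓ : ℝ} (hℓ : 1 ≤ ℓ)
    (hRℓ : Real.log R ≤ ℓ) {s t C L lam H M : ℝ} (hst : 2 ≤ s + t) (hC : 0 < C) (hL : 0 ≤ L)
    (hlam : 0 < lam) (hH : 0 < H) (hM : 0 ≤ M) {P : Finset (ℤ × ℤ)} (hP : P.Nonempty)
    (hPu : ∀ p ∈ P, p ∈ dyadicCover δ unitSquare) {Tp : ℤ × ℤ → Finset (ℤ × ℤ)}
    (hmeet : ∀ p ∈ P, ∀ q ∈ Tp p, (dyadicTube δ q ∩ dyadicSquare δ p).Nonempty)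
    (hβ : ∀ Q, ((P.filter fun p => anc A p = Q).card : ℝ) * (P.image (anc A)).card ≤
      2 * H * P.card)
    (hκ : ∀ Q, (((P.image (anc A)).filter fun p => anc N p = Q).card : ℝ) *
      ((P.image (anc A)).image (anc N)).card ≤ 4 * H * (P.image (anc A)).card)
    (hlow : 1 ≤ 8 * C * w ^ t * H * (P.image (anc A)).card)
    (hTp : ∀ p ∈ P, ∀ W, (((Tp p).filter fun q => anc A q = W).card : ℝ) ≤
      4 * C * w ^ s * (L * M))
    {𝒲 : Finset (ℤ × ℤ)} (hslope : ∀ W ∈ 𝒲, -2 ≤ W.1 * w ∧ (W.1 + 1) * w ≤ 2)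
    (hrich : ∀ W ∈ 𝒲, lam < richness w W (P.image (anc A)))
    (hbad : ∀ W ∈ 𝒲,
      192 * H * richness (N * w) (anc N W) ((P.image (anc A)).image (anc N)) <
        richness w W (P.image (anc A))) :
    lam * ∑ p ∈ P, (((Tp p).filter fun q => anc A q ∈ 𝒲).card : ℝ) ≤
      badConst * L * ℓ ^ 2 * H ^ 2 * C ^ 2 * N * (P.card * M) := by
  have hw0 : 0 < w := by rw [hw]; positivity
  have hNr : (24 : ℝ) ≤ N := by exact_mod_cast hN
  set D := P.image (anc A) with hDdef
  have hDne : D.Nonempty := hP.image _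
  have hc : (0 : ℝ) < D.card := by exact_mod_cast hDne.card_pos
  have hc' : (0 : ℝ) < (D.image (anc N)).card := by exact_mod_cast (hDne.image _).card_pos
  have hPc : (0 : ℝ) < P.card := by exact_mod_cast hP.card_pos
  have hws : 0 ≤ w ^ s := Real.rpow_nonneg hw0.le s
  have hwt : 0 ≤ w ^ t := Real.rpow_nonneg hw0.le t
  have hsq : ∑ W ∈ 𝒲, ((incident w W D).card : ℝ) ^ 2 ≤
      D.card * (9216 * corrConst * (N / w) * (2 * (2 + Real.log R)) ^ 2) := by
    -- This `κ` is the bound on the number of children given by uniformity; together with the factor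
    -- `48` it accounts for `192 = 48 * 4`.
    refine sum_incident_sq_le (κ := 4 * H * D.card / (D.image (anc N)).card) hw0 hN hR ?_ ?_
      hslope ?_
    · intro Q hQ
      obtain ⟨p, hp, rfl⟩ := Finset.mem_image.1 hQ
      exact mem_Ico_of_mem_dyadicCover_unitSquare hδ (by rw [← hw, hR]) (hPu p hp) hA
    · intro Q
      rw [le_div_iff₀ hc']
      exact hκ Q
    · intro W hW
      have h1 := (hbad W hW).le
      rw [card_incident_eq hw0 W hDne, card_incident_eq (by positivity) _ (hDne.image _)]
      calc _ = 192 * H * richness (N * w) (anc N W) (D.image (anc N)) * (N * (w * D.card)) := by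
            field_simp
            ring
        _ ≤ richness w W D * (N * (w * D.card)) := by gcongr
        _ = _ := by ring
  have hE : (2 * (2 + Real.log R)) ^ 2 ≤ 36 * ℓ ^ 2 := by
    have hlog : 0 ≤ Real.log R := Real.log_natCast_nonneg R
    calc _ ≤ (6 * ℓ) ^ 2 := pow_le_pow_left₀ (by linarith) (by linarith) 2
      _ = _ := by ring
  -- One factor of each square is bounded below by richness, turning the second moment into a first
  -- moment.
  have hS1 : lam * (w * D.card) * ∑ W ∈ 𝒲, ((incident w W D).card : ℝ) ≤
      D.card * (9216 * corrConst * (N / w) * (36 * ℓ ^ 2)) := by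
    refine le_trans ?_ (hsq.trans ?_)
    · rw [Finset.mul_sum]
      refine Finset.sum_le_sum fun W hW => ?_
      rw [sq]
      refine mul_le_mul_of_nonneg_right ?_ (Nat.cast_nonneg _)
      rw [card_incident_eq hw0 W hDne]
      exact mul_le_mul_of_nonneg_right (hrich W hW).le (by positivity)
    · have := corrConst_pos
      gcongr
  have hS2 : lam * ∑ W ∈ 𝒲, ((incident w W D).card : ℝ) ≤
      9216 * 36 * corrConst * N * ℓ ^ 2 / w ^ 2 := by
    rw [le_div_iff₀ (by positivity)]
    refine le_of_mul_le_mul_left ?_ hc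
    calc _ = w * (lam * (w * D.card) * ∑ W ∈ 𝒲, ((incident w W D).card : ℝ)) := by ring
      _ ≤ w * (D.card * (9216 * corrConst * (N / w) * (36 * ℓ ^ 2))) := by gcongr
      _ = _ := by field_simp
  -- This is where `s + t ≥ 2` enters.
  have hpow : w ^ s * w ^ t ≤ w ^ 2 := by
    rw [← Real.rpow_add hw0, ← Real.rpow_natCast w 2]
    exact Real.rpow_le_rpow_of_exponent_ge hw0 hw1 (by exact_mod_cast hst)
  have hsum := sum_card_filter_anc_le (𝒲 := 𝒲) (β := 2 * H * P.card / D.card)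
    (τ := 4 * C * w ^ s * (L * M)) hδ hA hmeet (by positivity)
    (fun Q => by rw [le_div_iff₀ hc]; exact hβ Q) hTp
  rw [← hw, ← hDdef, ← Finset.sum_mul, ← Finset.sum_mul] at hsum
  -- The lower bound on the number of `w`-squares supplies the factor `w ^ t`; the factor `w ^ s`
  -- comes from the tubes through a square.
  have hdiv : 2 * H * P.card / D.card ≤ 2 * H * P.card * (8 * C * w ^ t * H) := by
    rw [div_le_iff₀ hc]
    nlinarith [mul_pos hH hPc]
  have hCp := corrConst_pos
  calc _ ≤ lam * ((∑ W ∈ 𝒲, ((incident w W D).card : ℝ)) * (2 * H * P.card / D.card) *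
        (4 * C * w ^ s * (L * M))) := by gcongr
    _ = (lam * ∑ W ∈ 𝒲, ((incident w W D).card : ℝ)) * (2 * H * P.card / D.card) *
        (4 * C * w ^ s * (L * M)) := by ring
    _ ≤ (9216 * 36 * corrConst * N * ℓ ^ 2 / w ^ 2) * (2 * H * P.card * (8 * C * w ^ t * H)) *
        (4 * C * w ^ s * (L * M)) := by gcongr
    _ = (badConst * L * ℓ ^ 2 * H ^ 2 * C ^ 2 * N * (P.card * M)) *
        ((w ^ s * w ^ t) / w ^ 2) := by
        unfold badConst
        ring
    _ ≤ (badConst * L * ℓ ^ 2 * H ^ 2 * C ^ 2 * N * (P.card * M)) * 1 := by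
        have := one_le_badConst
        gcongr
        exact div_le_one_of_le₀ hpow (by positivity)
    _ = _ := mul_one _


/-! ### Construction of the refinement -/

/-- The refinement: a uniform set of squares, together with the tubes none of whose ancestors is
rich and richer than its parent. -/
theorem exists_refinement {L : ℝ} (hL : 1 ≤ L) {n : ℕ} (hn : 1 ≤ n) {N : ℕ} (hN : 24 ≤ N)
    {δ : ℝ} (hδ : 0 < δ) (hδN : (N : ℝ) ^ n * δ = 1) {ℓ : ℝ} (hℓ : 1 ≤ ℓ)
    (hNℓ : Real.log ((N : ℝ) ^ n) ≤ ℓ) {J H : ℕ} (hJ : Nat.log 2 (N ^ n * N ^ n) ≤ J)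
    (hH : H = (J + 1) ^ (n + 1)) {s t C : ℝ} {M : ℕ} (hs : s ≤ 2) (ht : t ≤ 2) (hst : 2 ≤ s + t)
    (hC : 0 < C) (X₀ : Configuration δ) (hnice : X₀.IsNice s C M L)
    (hP₀ : IsDeltaSet δ t C (unionSquares δ X₀.P)) {lam : ℝ}
    (hlam : lam = 2 * n * L ^ 2 * badConst * ℓ ^ 2 * H ^ 2 * C ^ 2 * N) :
    ∃ X : Configuration δ, X.P ⊆ X₀.P ∧ X.T ⊆ X₀.T ∧ (∀ p ∈ X.P, X.Tp p ⊆ X₀.Tp p) ∧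
      X₀.P.card ≤ H * X.P.card ∧
      (X.P.card : ℝ) * M ≤ 2 * L * ∑ p ∈ X.P, ((X.Tp p).card : ℝ) ∧
      X.P.Nonempty ∧
      ∀ k, 1 ≤ k → k ≤ n → ∀ q ∈ X.T,
        richness ((N ^ (n - k) : ℕ) * δ) (anc (N ^ (n - k)) q) (X.P.image (anc (N ^ (n - k)))) ≤
          (192 * H) ^ n * lam := by
  classical
  have hN0 : 0 < N := by omega
  have hNr : (24 : ℝ) ≤ N := by exact_mod_cast hN
  have hnr : (1 : ℝ) ≤ n := by exact_mod_cast hn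
  have hH1 : 1 ≤ H := hH ▸ Nat.one_le_pow _ _ (Nat.succ_pos J)
  have hHr : (1 : ℝ) ≤ H := by exact_mod_cast hH1
  have hApos : ∀ k, 0 < N ^ (n - k) := fun k => Nat.pow_pos hN0
  have hwpos : ∀ k, 0 < ((N ^ (n - k) : ℕ) : ℝ) * δ := fun k =>
    mul_pos (by exact_mod_cast hApos k) hδ
  have hRw : ∀ k ≤ n, ((N ^ k : ℕ) : ℝ) * ((N ^ (n - k) : ℕ) * δ) = 1 := by
    intro k hk
    rw [← mul_assoc, ← Nat.cast_mul, ← pow_add, Nat.add_sub_cancel' hk, Nat.cast_pow, hδN]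
  have hsucc : ∀ k, 1 ≤ k → k ≤ n → N ^ (n - k) * N = N ^ (n - (k - 1)) := by
    intro k h1 h2
    rw [← pow_succ]
    congr 1
    omega
  have hwle : ∀ k ≤ n, ((N ^ (n - k) : ℕ) : ℝ) * δ ≤ 1 := by
    intro k hk
    have h1 := hRw k hk
    have h2 : (1 : ℝ) ≤ (N ^ k : ℕ) := by exact_mod_cast Nat.one_le_pow _ _ hN0
    nlinarith [hwpos k]
  have hNw : ∀ k, 1 ≤ k → k ≤ n →
      (N : ℝ) * ((N ^ (n - k) : ℕ) * δ) = (N ^ (n - (k - 1)) : ℕ) * δ := by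
    intro k h1 h2
    rw [← hsucc k h1 h2]
    push_cast
    ring
  have hwle' : ∀ k, 1 ≤ k → k ≤ n → 2 * (((N ^ (n - k) : ℕ) : ℝ) * δ) ≤ 1 := by
    intro k h1 h2
    have h3 := hwle (k - 1) (by omega)
    rw [← hNw k h1 h2] at h3
    nlinarith [hwpos k]
  have hδ1 : δ ≤ 1 := by simpa using hwle n le_rfl
  have hC1 : 1 ≤ C := one_le_of_isDeltaSet hδ hδ1 hP₀ X₀.squares
  have hbC := one_le_badConst
  have hlam1 : 1 ≤ lam := by
    rw [hlam]
    have e1 : (1 : ℝ) ≤ 2 * n := by linarith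
    have e2 : (1 : ℝ) ≤ 2 * n * L ^ 2 := one_le_mul_of_one_le_of_one_le e1 (one_le_pow₀ hL)
    have e3 := one_le_mul_of_one_le_of_one_le e2 hbC
    have e4 := one_le_mul_of_one_le_of_one_le e3 (one_le_pow₀ hℓ (n := 2))
    have e5 := one_le_mul_of_one_le_of_one_le e4 (one_le_pow₀ hHr (n := 2))
    have e6 := one_le_mul_of_one_le_of_one_le e5 (one_le_pow₀ hC1 (n := 2))
    exact one_le_mul_of_one_le_of_one_le e6 (by linarith)
  have hcard : X₀.P.card ≤ N ^ n * N ^ n := by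
    have hsub : X₀.P ⊆ Finset.Ico (0 : ℤ) (N ^ n : ℕ) ×ˢ Finset.Ico (0 : ℤ) (N ^ n : ℕ) := by
      intro p hp
      have := mem_Ico_of_mem_dyadicCover_unitSquare (N := 1) (M := N ^ n) hδ
        (by push_cast; rw [one_mul, hδN]) (X₀.squares p hp) one_pos
      rw [anc_one] at this
      exact Finset.mem_product.2 this
    have := Finset.card_le_card hsub
    rwa [Finset.card_product, Int.card_Ico, sub_zero, Int.toNat_natCast] at this
  obtain ⟨P, hPsub, j, hPcard, hunif⟩ := exists_uniform_subset X₀.P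
    (fun k => anc (N ^ (n - k))) n J ((Nat.log_mono_right hcard).trans hJ)
  rw [← hH] at hPcard
  have hP₀ne := nonempty_of_isDeltaSet hP₀
  have hPne : P.Nonempty := by
    rw [← Finset.card_pos]
    exact Nat.pos_of_mul_pos_left (hP₀ne.card_pos.trans_le hPcard)
  have hPpos : (0 : ℝ) < P.card := by exact_mod_cast hPne.card_pos
  have hPcardr : (X₀.P.card : ℝ) ≤ H * P.card := by exact_mod_cast hPcard
  have himage : ∀ k, 1 ≤ k → k ≤ n →
      (P.image (anc (N ^ (n - k)))).image (anc N) = P.image (anc (N ^ (n - (k - 1)))) := by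
    intro k h1 h2
    rw [Finset.image_image, ← hsucc k h1 h2]
    exact Finset.image_congr fun p _ => anc_anc _ _ _
  set bad : ℕ → ℤ × ℤ → Prop := fun k W =>
    lam < richness ((N ^ (n - k) : ℕ) * δ) W (P.image (anc (N ^ (n - k)))) ∧
    192 * H * richness (N * ((N ^ (n - k) : ℕ) * δ)) (anc N W)
      ((P.image (anc (N ^ (n - k)))).image (anc N)) <
      richness ((N ^ (n - k) : ℕ) * δ) W (P.image (anc (N ^ (n - k)))) with hbaddef
  set good : ℤ × ℤ → Prop := fun q => ∀ k ∈ Finset.Icc 1 n, ¬ bad k (anc (N ^ (n - k)) q)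
    with hgooddef
  -- Each of the `n` scales may lose a share `1 / (2 n L)` of `|P| M`. All incidences together
  -- number at least `|P| M / L`, so half of this amount survives.
  have hbadcount : ∀ k ∈ Finset.Icc 1 n, 2 * n * L * ∑ p ∈ P,
      (((X₀.Tp p).filter fun q => bad k (anc (N ^ (n - k)) q)).card : ℝ) ≤ P.card * M := by
    intro k hk
    obtain ⟨hk1, hkn⟩ := Finset.mem_Icc.1 hk
    have hlow : ∀ p ∈ P, _ := fun p hp => (hunif k hkn p hp).1
    have hup : ∀ p ∈ P, _ := fun p hp => (hunif k hkn p hp).2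
    have hlow' : ∀ p ∈ P, _ := fun p hp => (hunif (k - 1) (by omega) p hp).1
    have hup' : ∀ p ∈ P, _ := fun p hp => (hunif (k - 1) (by omega) p hp).2
    have hsum := sum_card_bad_le (w := (N ^ (n - k) : ℕ) * δ) (R := N ^ k) (ℓ := ℓ) (s := s)
      (t := t) (C := C) (L := L) (lam := lam) (H := H) (M := M) (Tp := X₀.Tp)
      (𝒲 := (X₀.T.image (anc (N ^ (n - k)))).filter (bad k))
      hδ hN (hApos k) rfl (hRw k hkn) (hwle k hkn) hℓ ?_ hst hC (by linarith) (by linarith)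
      (by linarith) (Nat.cast_nonneg M) hPne (fun p hp => X₀.squares p (hPsub hp))
      (fun p hp => X₀.Tp_meets p (hPsub hp)) ?_ ?_ ?_ ?_ ?_ ?_ ?_
    · have hfil : ∀ p ∈ P, (X₀.Tp p).filter (fun q => anc (N ^ (n - k)) q ∈
          (X₀.T.image (anc (N ^ (n - k)))).filter (bad k)) =
          (X₀.Tp p).filter fun q => bad k (anc (N ^ (n - k)) q) := by
        intro p hp
        refine Finset.filter_congr fun q hq => ?_
        rw [Finset.mem_filter, and_iff_right]
        exact Finset.mem_image_of_mem _ (X₀.Tp_subset p (hPsub hp) hq)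
      rw [Finset.sum_congr rfl fun p hp => by rw [hfil p hp]] at hsum
      have hpos : 0 < badConst * L * ℓ ^ 2 * H ^ 2 * C ^ 2 * N := by positivity
      refine le_of_mul_le_mul_left (le_trans (le_of_eq ?_) hsum) hpos
      rw [← mul_assoc]
      exact congrArg (· * _) (by rw [hlam]; ring)
    · refine le_trans (Real.log_le_log (by exact_mod_cast Nat.pow_pos hN0) ?_) hNℓ
      rw [Nat.cast_pow]
      exact pow_le_pow_right₀ (by linarith) hkn
    · intro Q
      exact_mod_cast card_fiber_mul_le_of_uniform hPsub hPcard hlow hup Q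
    · intro Q
      have := card_children_mul_le_of_uniform (f := anc (N ^ (n - k)))
        (f' := anc (N ^ (n - (k - 1)))) (g := anc N)
        (fun p => by rw [anc_anc, hsucc k hk1 hkn]) hPsub hPcard hlow hup hlow' hup' Q
      rw [himage k hk1 hkn]
      exact_mod_cast this
    -- One fibre in `P₀` is small by the `(δ, t, C)` condition; by uniformity all fibres are, so
    -- there are many `w`-squares.
    · obtain ⟨p, hp⟩ := hPne
      have h1 : (P.card : ℝ) ≤ 2 ^ (j k + 1) * (P.image (anc (N ^ (n - k)))).card := by
        exact_mod_cast card_le_of_uniform hPsub hup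
      have h2 : (2 : ℝ) ^ j k ≤
          ((X₀.P.filter fun p' => anc (N ^ (n - k)) p' = anc (N ^ (n - k)) p).card : ℝ) := by
        exact_mod_cast hlow p hp
      have h3 := card_anc_eq_le_of_isDeltaSet hδ hC.le hP₀ ht (hApos k) (hwle' k hk1 hkn)
        (anc (N ^ (n - k)) p)
      have hwt := Real.rpow_nonneg (hwpos k).le t
      refine le_of_mul_le_mul_right ?_ hPpos
      calc 1 * (P.card : ℝ) ≤ 2 ^ (j k + 1) * (P.image (anc (N ^ (n - k)))).card := by
            rwa [one_mul]
        _ = 2 * 2 ^ j k * (P.image (anc (N ^ (n - k)))).card := by ring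
        _ ≤ 2 * (4 * C * (((N ^ (n - k) : ℕ) : ℝ) * δ) ^ t * (H * P.card)) *
            (P.image (anc (N ^ (n - k)))).card := by
            gcongr
            exact h2.trans (h3.trans (by gcongr))
        _ = _ := by ring
    · intro p hp W
      refine (card_anc_eq_le_of_isDeltaSet hδ hC.le (hnice.deltaSet p (hPsub hp)) hs (hApos k)
        (hwle' k hk1 hkn) W).trans ?_
      have hws := Real.rpow_nonneg (hwpos k).le s
      have := hnice.card_le p (hPsub hp)
      gcongr
    · intro W hW
      obtain ⟨q, hq, rfl⟩ := Finset.mem_image.1 (Finset.mem_filter.1 hW).1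
      exact slope_bounds (hwle k hkn) (anc_mem_dyadicCover hδ (hApos k) (X₀.tubes q hq))
    · intro W hW
      exact (Finset.mem_filter.1 hW).2.1
    · intro W hW
      exact (Finset.mem_filter.1 hW).2.2
  have hgoodcount : ∀ p ∈ P, ((X₀.Tp p).card : ℝ) ≤ (((X₀.Tp p).filter good).card : ℝ) +
      ∑ k ∈ Finset.Icc 1 n,
        (((X₀.Tp p).filter fun q => bad k (anc (N ^ (n - k)) q)).card : ℝ) := by
    intro p _
    have hsub : X₀.Tp p ⊆ (X₀.Tp p).filter good ∪ (Finset.Icc 1 n).biUnion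
        fun k => (X₀.Tp p).filter fun q => bad k (anc (N ^ (n - k)) q) := by
      intro q hq
      rw [Finset.mem_union, Finset.mem_filter, Finset.mem_biUnion]
      by_cases hg : good q
      · exact Or.inl ⟨hq, hg⟩
      · right
        simp only [hgooddef, not_forall, not_not] at hg
        obtain ⟨k, hk, hb⟩ := hg
        exact ⟨k, hk, Finset.mem_filter.2 ⟨hq, hb⟩⟩
    exact_mod_cast (Finset.card_le_card hsub).trans ((Finset.card_union_le _ _).trans
      (Nat.add_le_add_left Finset.card_biUnion_le _))
  refine ⟨{ P := P, T := X₀.T.filter good, Tp := fun p => (X₀.Tp p).filter good,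
            squares := fun p hp => X₀.squares p (hPsub hp)
            tubes := fun q hq => X₀.tubes q (Finset.mem_filter.1 hq).1
            Tp_subset := fun p hp =>
              Finset.filter_subset_filter _ (X₀.Tp_subset p (hPsub hp))
            Tp_meets := fun p hp q hq =>
              X₀.Tp_meets p (hPsub hp) q (Finset.mem_filter.1 hq).1 },
    hPsub, Finset.filter_subset _ _, fun p _ => Finset.filter_subset _ _, hPcard, ?_, hPne, ?_⟩
  · have h1 : (P.card : ℝ) * M ≤ L * ∑ p ∈ P, ((X₀.Tp p).card : ℝ) := by
      rw [Finset.mul_sum, ← nsmul_eq_mul, ← Finset.sum_const]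
      exact Finset.sum_le_sum fun p hp => hnice.le_card p (hPsub hp)
    have h2 := Finset.sum_le_sum hgoodcount
    rw [Finset.sum_add_distrib, Finset.sum_comm] at h2
    have h3 := Finset.sum_le_sum hbadcount
    rw [← Finset.mul_sum, Finset.sum_const, Nat.card_Icc, Nat.add_sub_cancel, nsmul_eq_mul] at h3
    have h4 : 2 * L * ∑ k ∈ Finset.Icc 1 n, ∑ p ∈ P,
        (((X₀.Tp p).filter fun q => bad k (anc (N ^ (n - k)) q)).card : ℝ) ≤ P.card * M := by
      refine le_of_mul_le_mul_left (le_trans (le_of_eq ?_) h3) (zero_lt_one.trans_le hnr)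
      ring
    have h5 := mul_le_mul_of_nonneg_left h2 (zero_le_one.trans hL)
    simp only
    nlinarith
  · intro k _ hk q hq
    simp only
    have hgood := (Finset.mem_filter.1 hq).2
    have hHge : (1 : ℝ) ≤ 192 * H := by linarith
    -- Induction on the scale: a surviving ancestor either has richness at most `lam`, or at most
    -- `192 H` times that of its parent.
    have key : ∀ k ≤ n, richness ((N ^ (n - k) : ℕ) * δ) (anc (N ^ (n - k)) q)
        (P.image (anc (N ^ (n - k)))) ≤ (192 * H) ^ k * lam := by
      intro k
      induction k with
      | zero =>
        intro _
        have h1 : ((N ^ (n - 0) : ℕ) : ℝ) * δ = 1 := by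
          rw [Nat.sub_zero, Nat.cast_pow, hδN]
        rw [h1, pow_zero, one_mul]
        exact (richness_one_le _ _).trans hlam1
      | succ k ih =>
        intro hk
        have hb := hgood (k + 1) (Finset.mem_Icc.2 ⟨by omega, hk⟩)
        have ih' := ih (by omega)
        simp only [hbaddef, not_and_or, not_lt] at hb
        rcases hb with hb | hb
        · refine hb.trans ?_
          nlinarith [one_le_pow₀ hHge (n := k + 1)]
        · rw [himage (k + 1) (by omega) hk, hNw (k + 1) (by omega) hk, anc_anc,
            hsucc (k + 1) (by omega) hk, Nat.add_sub_cancel] at hb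
          refine hb.trans ?_
          have h192 : (0 : ℝ) ≤ 192 * H := by linarith
          exact (mul_le_mul_of_nonneg_left ih' h192).trans_eq (by ring)
    refine (key k hk).trans ?_
    have : 0 ≤ lam := by linarith
    gcongr


/-! ### Bookkeeping of logarithms and conclusion -/

theorem log_two_pow_sq (m n : ℕ) : Nat.log 2 ((2 ^ m) ^ n * (2 ^ m) ^ n) = 2 * (m * n) := by
  rw [← pow_mul, ← pow_add, Nat.log_pow one_lt_two]
  ring

/-- The number of size classes in the pigeonholing is at most a power of `log (1 / δ)`. -/
theorem two_mul_add_one_le (x : ℕ) {ℓ : ℝ} (hℓ : 1 ≤ ℓ) (h : ℓ = x * Real.log 2) :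
    ((2 * x + 1 : ℕ) : ℝ) ≤ 5 * ℓ := by
  have h2 := Real.log_two_gt_d9
  have hx : (0 : ℝ) ≤ x := Nat.cast_nonneg x
  push_cast
  nlinarith

/-- The tubes of a configuration are at least as many as its incidences divided by the maximal
richness of a tube. -/
theorem sum_card_Tp_le {δ : ℝ} (hδ : 0 < δ) (X : Configuration δ) {r : ℝ}
    (hr : ∀ q ∈ X.T, ((incident δ q X.P).card : ℝ) ≤ r) :
    ∑ p ∈ X.P, ((X.Tp p).card : ℝ) ≤ X.T.card * r := by
  have h1 : ∀ p ∈ X.P, (((X.Tp p).filter fun q => anc 1 q ∈ X.T).card : ℝ) =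
      ((X.Tp p).card : ℝ) := by
    intro p hp
    rw [Finset.filter_true_of_mem]
    intro q hq
    rw [anc_one]
    exact X.Tp_subset p hp hq
  have hcard : ∀ (D : Finset (ℤ × ℤ)) (Q : ℤ × ℤ),
      ((D.filter fun p => anc 1 p = Q).card : ℝ) ≤ 1 := by
    intro D Q
    refine Nat.cast_le_one.2 (Finset.card_le_one.2 fun p hp p' hp' => ?_)
    have e := (Finset.mem_filter.1 hp).2
    have e' := (Finset.mem_filter.1 hp').2
    rw [anc_one] at e e'
    rw [e, e']
  have h2 := sum_card_filter_anc_le (𝒲 := X.T) (β := 1) (τ := 1) hδ one_pos X.Tp_meets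
    zero_le_one (hcard _) fun p _ W => hcard _ W
  rw [Finset.sum_congr rfl h1, Nat.cast_one, one_mul, show anc 1 = id from funext anc_one,
    Finset.image_id] at h2
  simp only [mul_one] at h2
  refine h2.trans ?_
  rw [← nsmul_eq_mul]
  exact Finset.sum_le_card_nsmul _ _ r hr

end HighLow

open HighLow in
theorem mainTheorem7 :
    ∃ Δ₀ : ℝ, 0 < Δ₀ ∧ Δ₀ < 1 ∧
      ∀ (L : ℝ), 1 ≤ L → ∀ (n : ℕ), 1 ≤ n →
      ∃ (A : ℕ) (B : ℝ) (K : ℝ → ℝ),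
        ∀ (m : ℕ) (Δ δ : ℝ), Δ = (1 / 2 : ℝ) ^ m → Δ < Δ₀ → δ = Δ ^ n →
        ∀ (s t C₀ : ℝ) (M₀ : ℕ), 0 ≤ s → s ≤ 1 → 0 ≤ t → t ≤ 2 → 2 ≤ s + t → 0 < C₀ →
        ∀ X₀ : Configuration δ, X₀.IsNice s C₀ M₀ L →
          IsDeltaSet δ t C₀ (unionSquares δ X₀.P) →
        ∃ X : Configuration δ, X.IsRefinement X₀ M₀ B A ∧
          ∀ ε : ℝ, 0 < ε → ε ≤ 1 / (n : ℝ) →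
            (∀ k : ℕ, 1 ≤ k → k ≤ n → ∀ q ∈ X.T, ∀ W : ℤ × ℤ,
              W ∈ dyadicCover (Δ ^ k) slopeStrip → dyadicTube δ q ⊆ dyadicTube (Δ ^ k) W →
              (incidenceCount (Δ ^ k) W (unionSquares δ X.P) : ℝ) ≤
                K ε * Real.log (1 / δ) ^ A *
                  (C₀ ^ 2 * Δ⁻¹ * (coveringNumber (Δ ^ k) (unionSquares δ X.P) : ℝ) *
                    (Δ ^ k) ^ (1 - ε))) ∧
            δ ^ (-1 + ε) * (M₀ : ℝ) ≤
              K ε * Real.log (1 / δ) ^ A * (C₀ ^ 2 * Δ⁻¹ * (X.T.card : ℝ)) := by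
  refine ⟨1 / 24, by norm_num, by norm_num, fun L hL n hn => ?_⟩
  have hbC := one_le_badConst
  have hnr : (1 : ℝ) ≤ n := by exact_mod_cast hn
  -- With `H ≤ (5 ℓ) ^ (n + 1)`, the product `(192 H) ^ n * lam` contains `H ^ (n + 2) * ℓ ^ 2`.
  -- This explains the power of `5` and the exponent `A = (n + 1) * (n + 2) + 2`.
  set K₀ : ℝ := 192 ^ n * 5 ^ ((n + 1) * (n + 2)) * (2 * n * L ^ 2 * badConst) with hK₀
  have hK₀pos : 0 < K₀ := by positivity
  -- The constant does not depend on `ε`: the argument gives the exponent `1` itself, which is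
  -- stronger since `Δ ^ k ≤ 1`.
  refine ⟨(n + 1) * (n + 2) + 2, 2 * L * 5 ^ (n + 1), fun _ => 2 * L * K₀, ?_⟩
  intro m Δ δ hΔ hΔ₀ hδ s t C₀ M₀ _ hs1 _ ht2 hst hC₀ X₀ hnice hP₀
  set N : ℕ := 2 ^ m with hNdef
  have hN0 : 0 < N := Nat.pow_pos two_pos
  have hNrpos : (0 : ℝ) < N := by exact_mod_cast hN0
  have hΔN : Δ = (N : ℝ)⁻¹ := by rw [hΔ, hNdef]; simp
  have hΔpos : 0 < Δ := by rw [hΔN]; positivity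
  have hN24 : 24 ≤ N := by
    have h1 : (24 : ℝ) < N := by
      rw [hΔN, one_div] at hΔ₀
      exact (inv_lt_inv₀ hNrpos (by norm_num)).1 hΔ₀
    exact_mod_cast h1.le
  have hΔ1 : Δ ≤ 1 := hΔ₀.le.trans (by norm_num)
  have hδpos : 0 < δ := by rw [hδ]; positivity
  have hδN : (N : ℝ) ^ n * δ = 1 := by
    rw [hδ, hΔN, inv_pow]
    exact mul_inv_cancel₀ (by positivity)
  set ℓ : ℝ := Real.log (1 / δ) with hℓdef
  have hNδ : (N : ℝ) ^ n = 1 / δ := by rw [eq_div_iff hδpos.ne', hδN]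
  have hℓeq : ℓ = (m * n : ℕ) * Real.log 2 := by
    rw [hℓdef, ← hNδ, hNdef, Nat.cast_pow, ← pow_mul, Real.log_pow, Nat.cast_ofNat]
  have hℓ1 : 1 ≤ ℓ := by
    rw [hℓdef, ← hNδ, Real.log_pow]
    have h1 : 1 ≤ Real.log N := by
      rw [Real.le_log_iff_exp_le hNrpos]
      have h2 : (24 : ℝ) ≤ N := by exact_mod_cast hN24
      linarith [Real.exp_one_lt_d9]
    exact one_le_mul_of_one_le_of_one_le hnr h1
  set J : ℕ := 2 * (m * n) with hJdef
  set H : ℕ := (J + 1) ^ (n + 1) with hHdef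
  have hHℓ : (H : ℝ) ≤ 5 ^ (n + 1) * ℓ ^ (n + 1) := by
    rw [hHdef, Nat.cast_pow, ← mul_pow]
    exact pow_le_pow_left₀ (Nat.cast_nonneg _) (two_mul_add_one_le _ hℓ1 hℓeq) _
  have hJ : Nat.log 2 (N ^ n * N ^ n) ≤ J := (log_two_pow_sq m n).le
  clear_value N ℓ J H
  set lam : ℝ := 2 * n * L ^ 2 * badConst * ℓ ^ 2 * H ^ 2 * C₀ ^ 2 * N with hlam
  obtain ⟨X, hXP, hXT, hXTp, hcardP, hcardTp, hne, hrich⟩ := exists_refinement hL hn hN24 hδpos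
    hδN hℓ1 (by rw [hNδ, hℓdef]) hJ hHdef (by linarith) ht2 hst hC₀ X₀ hnice hP₀
    hlam
  have hΛ : (192 * H) ^ n * lam ≤ K₀ * ℓ ^ ((n + 1) * (n + 2) + 2) * (C₀ ^ 2 * Δ⁻¹) := by
    rw [hΔN, inv_inv]
    calc _ = 192 ^ n * (H : ℝ) ^ (n + 2) * (2 * n * L ^ 2 * badConst) * ℓ ^ 2 *
          (C₀ ^ 2 * N) := by
          rw [hlam]
          ring
      _ ≤ 192 ^ n * (5 ^ (n + 1) * ℓ ^ (n + 1)) ^ (n + 2) * (2 * n * L ^ 2 * badConst) * ℓ ^ 2 *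
          (C₀ ^ 2 * N) := by gcongr
      _ = _ := by
          rw [mul_pow, ← pow_mul, ← pow_mul, hK₀]
          ring
  clear_value lam K₀
  have hHA : (H : ℝ) ≤ 5 ^ (n + 1) * ℓ ^ ((n + 1) * (n + 2) + 2) := by
    refine hHℓ.trans (mul_le_mul_of_nonneg_left (pow_le_pow_right₀ hℓ1 ?_) (by positivity))
    nlinarith
  have hL0 : 0 < L := by linarith
  have hcardPr : (X₀.P.card : ℝ) ≤ H * X.P.card := by exact_mod_cast hcardP
  have hw : ∀ k ≤ n, Δ ^ k = (N ^ (n - k) : ℕ) * δ := by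
    intro k hk
    have h1 : Δ ^ (n - k) * ((N ^ (n - k) : ℕ) : ℝ) = 1 := by
      rw [hΔN, Nat.cast_pow, ← mul_pow, inv_mul_cancel₀ hNrpos.ne', one_pow]
    rw [hδ, ← Nat.add_sub_cancel' hk, pow_add, Nat.add_sub_cancel' hk]
    linear_combination (-Δ ^ k) * h1
  refine ⟨X, ⟨hXP, hXT, hXTp, ?_, ?_⟩, fun ε hε _ => ⟨?_, ?_⟩⟩
  · rw [← hℓdef]
    refine hcardPr.trans (mul_le_mul_of_nonneg_right (hHA.trans ?_) (Nat.cast_nonneg _))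
    have : (0 : ℝ) ≤ 5 ^ (n + 1) * ℓ ^ ((n + 1) * (n + 2) + 2) := by positivity
    nlinarith
  · rw [← hℓdef]
    calc (X₀.P.card : ℝ) * M₀ ≤ H * (X.P.card * M₀) := by
          rw [← mul_assoc]
          gcongr
      _ ≤ (5 ^ (n + 1) * ℓ ^ ((n + 1) * (n + 2) + 2)) *
          (2 * L * ∑ p ∈ X.P, ((X.Tp p).card : ℝ)) := by gcongr
      _ = _ := by ring
  · intro k hk1 hkn q hq W _ hqW
    beta_reduce
    have hApos : 0 < N ^ (n - k) := Nat.pow_pos hN0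
    have hwpos : 0 < Δ ^ k := by positivity
    have hr := hrich k hk1 hkn q hq
    rw [hw k hkn] at hqW
    obtain rfl := eq_anc_of_dyadicTube_subset hδpos hApos hqW
    have hpow : Δ ^ k ≤ (Δ ^ k) ^ (1 - ε) := by
      conv_lhs => rw [← Real.rpow_one (Δ ^ k)]
      exact Real.rpow_le_rpow_of_exponent_ge hwpos (pow_le_one₀ hΔpos.le hΔ1) (by linarith)
    have hcount : (incidenceCount (Δ ^ k) (anc (N ^ (n - k)) q) (unionSquares δ X.P) : ℝ) =
        richness (Δ ^ k) (anc (N ^ (n - k)) q) (X.P.image (anc (N ^ (n - k)))) *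
          (Δ ^ k * coveringNumber (Δ ^ k) (unionSquares δ X.P)) := by
      rw [hw k hkn, incidenceCount_unionSquares hδpos hApos,
        coveringNumber_unionSquares hδpos hApos]
      exact card_incident_eq (by rwa [← hw k hkn]) _ (hne.image _)
    rw [← hw k hkn] at hr
    rw [hcount]
    calc _ ≤ (K₀ * ℓ ^ ((n + 1) * (n + 2) + 2) * (C₀ ^ 2 * Δ⁻¹)) *
          ((Δ ^ k) ^ (1 - ε) * coveringNumber (Δ ^ k) (unionSquares δ X.P)) := by
          gcongr
          exact hr.trans hΛ
      _ = K₀ * ℓ ^ ((n + 1) * (n + 2) + 2) * (C₀ ^ 2 * Δ⁻¹ *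
          coveringNumber (Δ ^ k) (unionSquares δ X.P) * (Δ ^ k) ^ (1 - ε)) := by ring
      _ ≤ _ := by
          have h2L : K₀ ≤ 2 * L * K₀ := le_mul_of_one_le_left hK₀pos.le (by linarith)
          gcongr
  · beta_reduce
    have hPpos : (0 : ℝ) < X.P.card := by exact_mod_cast hne.card_pos
    have hδ1 : δ ≤ 1 := by rw [hδ]; exact pow_le_one₀ hΔpos.le hΔ1
    have hinc : ∀ q ∈ X.T, ((incident δ q X.P).card : ℝ) ≤
        K₀ * ℓ ^ ((n + 1) * (n + 2) + 2) * (C₀ ^ 2 * Δ⁻¹) * (δ * X.P.card) := by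
      intro q hq
      have hr := hrich n hn le_rfl q hq
      rw [Nat.sub_self, pow_zero, Nat.cast_one, one_mul, anc_one,
        show anc 1 = id from funext anc_one, Finset.image_id] at hr
      rw [card_incident_eq hδpos q hne]
      exact mul_le_mul_of_nonneg_right (hr.trans hΛ) (by positivity)
    -- Double counting at scale `δ`: each tube is incident to at most the bounded richness times `δ
    -- |P|` squares, and `|P|` cancels.
    have h1 := sum_card_Tp_le hδpos X hinc
    have h2 : (M₀ : ℝ) ≤ 2 * L * (X.T.card *
        (K₀ * ℓ ^ ((n + 1) * (n + 2) + 2) * (C₀ ^ 2 * Δ⁻¹) * δ)) := by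
      refine le_of_mul_le_mul_left ?_ hPpos
      calc _ ≤ 2 * L * ∑ p ∈ X.P, ((X.Tp p).card : ℝ) := hcardTp
        _ ≤ 2 * L * (X.T.card *
          (K₀ * ℓ ^ ((n + 1) * (n + 2) + 2) * (C₀ ^ 2 * Δ⁻¹) * (δ * X.P.card))) := by gcongr
        _ = _ := by ring
    have hpow : δ ^ (-1 + ε) ≤ δ⁻¹ := by
      rw [← Real.rpow_neg_one]
      exact Real.rpow_le_rpow_of_exponent_ge hδpos hδ1 (by linarith)
    calc _ ≤ δ⁻¹ * (2 * L * (X.T.card *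
          (K₀ * ℓ ^ ((n + 1) * (n + 2) + 2) * (C₀ ^ 2 * Δ⁻¹) * δ))) := by gcongr
      _ = _ := by field_simp
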